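/- Let $X$ be a compact, possibly disconnected 3-manifold given by a (generalised) triangulation, i.e. by finitely many tetrahedra whose faces are glued in pairs by affine maps, no edge being identified with its own reverse and every vertex link being a sphere or a disc. Suppose that two different boundary components $T_0$ and $T_1$ of $X$ are tori on each of which the triangulation restricts to a one-vertex triangulation (one vertex, three edges, two triangles). Let $\alpha_0$ be a slope on $T_0$ and $\alpha_1$ a slope on $T_1$, and let $D \in \mathbb N$ (with $D=0$ allowed). Here a slope is an unoriented primitive class $\pm(a,b)$, $\gcd(a,b)=1$, in the first homology $\mathbb Z^2$ of the torus, two slopes $\pm(a,b)$, $\pm(c,d)$ are adjacent in the Farey graph if $|ad-bc|=1$, and the Farey distance $d_{\mathcal F}$ is the distance in this graph. To layer a tetrahedron on a one-vertex torus $T$ in the boundary, at an edge $e$ of $T$, is to glue two adjacent faces of a new tetrahedron to the two triangles of $T$, the common edge of the two faces being glued to $e$; the two other faces of the tetrahedron then form the new boundary torus, in whose triangulation the diagonal $e$ of the rectangle bounded by the two other edges has been replaced by the other diagonal, and whose slopes are identified with those of $T$ through these two other edges. Then one can layer $2D$ tetrahedra, one after the other, on $T_0$, and afterwards glue the resulting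 boundary torus to $T_1$ by a simplicial isomorphism, such that the result $X'$ is a triangulated 3-manifold, orientable if $X$ is orientable, with $$t(X') = t(X) + 2D, \qquad d_{\mathcal F}(\alpha_0,\alpha_1) > D,$$ where $t(\cdot)$ is the number of tetrahedra and the distance is measured in the common image of $T_0$ and $T_1$ in $X'$. -/

import Mathlib

open Equiv

/-! ### Triangulations of 3-manifolds -/

/-- A (generalised, possibly disconnected) triangulation: finitely many tetrahedra, each with
vertices `0, 1, 2, 3`, some of whose faces are glued in pairs by affine maps.  The `k`-th face of a
tetrahedron is the one opposite to the vertex `k`.  `glue t k = none` means that this face is not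
glued to anything, and `glue t k = some (t', σ)` means that it is glued to the face `σ k` of `t'`,
the vertex `i ≠ k` of `t` going to the vertex `σ i` of `t'`. -/
structure Triangulation where
  Tet : Type
  finite : Finite Tet
  glue : Tet → Fin 4 → Option (Tet × Perm (Fin 4))
  glue_symm : ∀ t k t' σ, glue t k = some (t', σ) → glue t' (σ k) = some (t, σ⁻¹)
  glue_ne : ∀ t k t' σ, glue t k = some (t', σ) → (t', σ k) ≠ (t, k)

namespace Triangulation

variable (X : Triangulation)

/-- The number of tetrahedra. -/
noncomputable def numTet : ℕ := Nat.card X.Tet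

/-- A face is in the boundary if it is not glued. -/
def IsBoundary (f : X.Tet × Fin 4) : Prop := X.glue f.1 f.2 = none

/-- The gluing of one face identifies the vertex `(t, i)` with another one. -/
def VertexStep (a b : X.Tet × Fin 4) : Prop :=
  ∃ k σ, k ≠ a.2 ∧ X.glue a.1 k = some (b.1, σ) ∧ b.2 = σ a.2

/-- The gluing of one face identifies the oriented edge `(t, i, j)`, from the vertex `i` to the
vertex `j` of `t`, with another one. -/
def EdgeStep (a b : X.Tet × Fin 4 × Fin 4) : Prop :=
  ∃ k σ, k ≠ a.2.1 ∧ k ≠ a.2.2 ∧ X.glue a.1 k = some (b.1, σ) ∧ b.2 = (σ a.2.1, σ a.2.2)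

/-- The gluing of the face `k` of `t` identifies its corner `(t, i, k)` at the vertex `i ≠ k` with
a corner of another face. -/
def CornerStep (a b : X.Tet × Fin 4 × Fin 4) : Prop :=
  ∃ σ, X.glue a.1 a.2.2 = some (b.1, σ) ∧ b.2 = (σ a.2.1, σ a.2.2)

/-- Two vertices of tetrahedra are the same vertex of the triangulation. -/
def vertexSetoid : Setoid (X.Tet × Fin 4) := Relation.EqvGen.setoid X.VertexStep

/-- Two oriented edges of tetrahedra are the same oriented edge of the triangulation. -/
def edgeSetoid : Setoid (X.Tet × Fin 4 × Fin 4) := Relation.EqvGen.setoid X.EdgeStep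

/-- Two corners of faces of tetrahedra are the same corner in the triangulation. -/
def cornerSetoid : Setoid (X.Tet × Fin 4 × Fin 4) := Relation.EqvGen.setoid X.CornerStep

/-- Identification of vertices of tetrahedra. -/
def VertexEqv (a b : X.Tet × Fin 4) : Prop := X.vertexSetoid a b

/-- Identification of oriented edges of tetrahedra. -/
def EdgeEqv (a b : X.Tet × Fin 4 × Fin 4) : Prop := X.edgeSetoid a b

/-! The link of a vertex `v` is the connected surface made of one triangle for every vertex of a
tetrahedron that is identified with `v`; its edges are the corners of faces at `v`, and its
vertices are the (germs at `v` of) edges that start at `v`. -/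

/-- The triangles of the link of `v`. -/
def linkTriangles (v : X.Tet × Fin 4) : Set (X.Tet × Fin 4) := {a | X.VertexEqv a v}

/-- The edges of the link of `v`. -/
def linkEdges (v : X.Tet × Fin 4) : Set (Quotient X.cornerSetoid) :=
  {c | ∃ t i k, i ≠ k ∧ X.VertexEqv (t, i) v ∧ c = Quotient.mk _ (t, i, k)}

/-- The vertices of the link of `v`. -/
def linkVertices (v : X.Tet × Fin 4) : Set (Quotient X.edgeSetoid) :=
  {e | ∃ t i j, i ≠ j ∧ X.VertexEqv (t, i) v ∧ e = Quotient.mk _ (t, i, j)}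

/-- The Euler characteristic of the link of `v`. -/
noncomputable def linkEuler (v : X.Tet × Fin 4) : ℤ :=
  (X.linkVertices v).ncard - (X.linkEdges v).ncard + (X.linkTriangles v).ncard

/-- The boundary edges of the link of `v`: the corners `(t, i, k)` at `v` of boundary faces. -/
def linkBoundary (v : X.Tet × Fin 4) : Set (X.Tet × Fin 4 × Fin 4) :=
  {c | c.2.1 ≠ c.2.2 ∧ X.VertexEqv (c.1, c.2.1) v ∧ X.IsBoundary (c.1, c.2.2)}

/-- Two boundary edges of the link of `v` have a common endpoint. -/
def LinkBoundaryAdj (v : X.Tet × Fin 4) (c d : X.Tet × Fin 4 × Fin 4) : Prop :=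
  c ∈ X.linkBoundary v ∧ d ∈ X.linkBoundary v ∧
    ∃ j j', j ≠ c.2.1 ∧ j ≠ c.2.2 ∧ j' ≠ d.2.1 ∧ j' ≠ d.2.2 ∧
      X.EdgeEqv (c.1, c.2.1, j) (d.1, d.2.1, j')

/-- The link of `v` is a 2-sphere: a (connected) surface without boundary of
Euler characteristic 2. -/
def LinkIsSphere (v : X.Tet × Fin 4) : Prop :=
  X.linkBoundary v = ∅ ∧ X.linkEuler v = 2

/-- The link of `v` is a disc: a (connected) surface with exactly one boundary circle and
Euler characteristic 1. -/
def LinkIsDisc (v : X.Tet × Fin 4) : Prop :=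
  (X.linkBoundary v).Nonempty ∧
  (∀ c ∈ X.linkBoundary v, ∀ d ∈ X.linkBoundary v, Relation.EqvGen (X.LinkBoundaryAdj v) c d) ∧
  X.linkEuler v = 1

/-- The triangulated space is a compact 3-manifold (possibly disconnected, possibly with
boundary): no edge is identified with itself in reverse, and the link of every vertex is a sphere
or a disc. -/
def IsManifold : Prop :=
  (∀ t i j, i ≠ j → ¬ X.EdgeEqv (t, i, j) (t, j, i)) ∧
  ∀ v, X.LinkIsSphere v ∨ X.LinkIsDisc v

/-- The tetrahedra can be oriented so that all face gluings are compatible with the orientations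
(`o t = 1` means that `t` is oriented by the order `0, 1, 2, 3` of its vertices; a gluing of two
tetrahedra oriented in this way has to be an odd permutation). -/
def IsOrientable : Prop :=
  ∃ o : X.Tet → ℤˣ, ∀ t k t' σ, X.glue t k = some (t', σ) → o t' = - (Perm.sign σ * o t)

/-! ### One-vertex tori in the boundary -/

/-- A face of a tetrahedron with an order `(l 0, l 1, l 2)` on its vertices, written as a
permutation `l` whose last value `l 3` is the opposite vertex. -/
abbrev LFace : Type := X.Tet × Perm (Fin 4)

variable {X}

/-- The underlying face. -/
def LFace.face (l : X.LFace) : X.Tet × Fin 4 := (l.1, l.2 3)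

/-- The oriented edge from the `a`-th to the `b`-th vertex. -/
def LFace.edge (l : X.LFace) (a b : Fin 4) : X.Tet × Fin 4 × Fin 4 := (l.1, l.2 a, l.2 b)

/-- Change of the order of the vertices. -/
def LFace.relabel (l : X.LFace) (c : Perm (Fin 4)) : X.LFace := (l.1, l.2 * c)

variable (X)

/-- A torus boundary component with a one-vertex triangulation (one vertex, three edges, two
faces), with labels: a rectangle with corners `A, B, C, E` (in cyclic order), opposite sides of
which are identified by translations, is cut along its diagonal from `A` to `C` into the boundary
faces `p = (A, B, C)` and `q = (A, E, C)`.  Its edges are `x = AB = EC`, `y = BC = AE` and the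
diagonal `z = AC`. -/
structure OneVertexTorus where
  p : X.LFace
  q : X.LFace
  boundary_p : X.IsBoundary p.face
  boundary_q : X.IsBoundary q.face
  face_ne : p.face ≠ q.face
  edge_x : X.EdgeEqv (p.edge 0 1) (q.edge 1 2)
  edge_y : X.EdgeEqv (p.edge 1 2) (q.edge 0 1)
  edge_z : X.EdgeEqv (p.edge 0 2) (q.edge 0 2)

variable {X}

/-- The two faces of the torus. -/
def OneVertexTorus.faces (T : X.OneVertexTorus) : Set (X.Tet × Fin 4) := {T.p.face, T.q.face}

theorem EdgeEqv.reverse {t t' : X.Tet} {i j i' j' : Fin 4}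
    (h : X.EdgeEqv (t, i, j) (t', i', j')) : X.EdgeEqv (t, j, i) (t', j', i') := by
  have key : ∀ a b, Relation.EqvGen X.EdgeStep a b →
      Relation.EqvGen X.EdgeStep (a.1, a.2.2, a.2.1) (b.1, b.2.2, b.2.1) := by
    intro a b hab
    induction hab with
    | rel a b h =>
      obtain ⟨k, σ, h1, h2, h3, h4⟩ := h
      exact .rel _ _ ⟨k, σ, h2, h1, h3, by simp [h4]⟩
    | refl a => exact .refl _
    | symm a b _ ih => exact .symm _ _ ih
    | trans a b c _ _ ih1 ih2 => exact .trans _ _ _ ih1 ih2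
  exact key _ _ h

theorem EdgeEqv.symm {a b : X.Tet × Fin 4 × Fin 4} (h : X.EdgeEqv a b) : X.EdgeEqv b a :=
  Relation.EqvGen.symm _ _ h

theorem EdgeEqv.trans {a b c : X.Tet × Fin 4 × Fin 4} (h : X.EdgeEqv a b) (h' : X.EdgeEqv b c) :
    X.EdgeEqv a c :=
  Relation.EqvGen.trans _ _ _ h h'

/-- Oriented edges that are identified in `X` stay identified after a map of the tetrahedra that
respects the gluings of faces. -/
theorem EdgeEqv.map {Y : Triangulation} (f : X.Tet → Y.Tet)
    (hf : ∀ t k t' σ, X.glue t k = some (t', σ) → Y.glue (f t) k = some (f t', σ))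
    {a b : X.Tet × Fin 4 × Fin 4} (h : X.EdgeEqv a b) :
    Y.EdgeEqv (f a.1, a.2) (f b.1, b.2) := by
  have key : ∀ a b, Relation.EqvGen X.EdgeStep a b →
      Relation.EqvGen Y.EdgeStep (f a.1, a.2) (f b.1, b.2) := by
    intro a b hab
    induction hab with
    | rel a b h =>
      obtain ⟨k, σ, h1, h2, h3, h4⟩ := h
      exact .rel _ _ ⟨k, σ, h1, h2, hf _ _ _ _ h3, h4⟩
    | refl a => exact .refl _
    | symm a b _ ih => exact .symm _ _ ih
    | trans a b c _ _ ih1 ih2 => exact .trans _ _ _ ih1 ih2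
  exact key _ _ h

namespace OneVertexTorus

/-- The cyclic permutation `0 ↦ 1 ↦ 2 ↦ 0`. -/
def cyc : Perm (Fin 4) := swap 0 1 * swap 1 2

/-- The same torus with other labels: the new `x, y, z` are `y, -z, -x`. -/
def rotate (T : X.OneVertexTorus) : X.OneVertexTorus where
  p := T.p.relabel cyc
  q := T.q.relabel cyc⁻¹
  boundary_p := T.boundary_p
  boundary_q := T.boundary_q
  face_ne := T.face_ne
  edge_x := T.edge_y
  edge_y := T.edge_z.reverse
  edge_z := T.edge_x.reverse

/-- The same torus with other labels: the new `x, y, z` are `y, x, z`. -/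
def exchange (T : X.OneVertexTorus) : X.OneVertexTorus where
  p := T.q
  q := T.p
  boundary_p := T.boundary_q
  boundary_q := T.boundary_p
  face_ne := T.face_ne.symm
  edge_x := T.edge_y.symm
  edge_y := T.edge_x.symm
  edge_z := T.edge_z.symm

/-- The same torus with other labels: the new `x, y, z` are `-y, -x, -z`. -/
def reverse (T : X.OneVertexTorus) : X.OneVertexTorus where
  p := T.p.relabel (swap 0 2)
  q := T.q.relabel (swap 0 2)
  boundary_p := T.boundary_p
  boundary_q := T.boundary_q
  face_ne := T.face_ne
  edge_x := T.edge_y.reverse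
  edge_y := T.edge_x.reverse
  edge_z := T.edge_z.reverse

end OneVertexTorus

/-! ### Layering -/

open Classical in
/-- The face gluings after layering: the new tetrahedron `none` has the vertices
`A = 0, B = 1, C = 2, E = 3`; its lower faces `ABC` and `AEC` are glued to `p` and `q`. -/
noncomputable def layerGlue (T : X.OneVertexTorus) :
    Option X.Tet → Fin 4 → Option (Option X.Tet × Perm (Fin 4))
  | none, k =>
    if k = 3 then some (some T.p.1, T.p.2)
    else if k = 1 then some (some T.q.1, T.q.2 * swap 1 3)
    else none
  | some t, k =>
    if (t, k) = T.p.face then some (none, T.p.2⁻¹)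
    else if (t, k) = T.q.face then some (none, (T.q.2 * swap 1 3)⁻¹)
    else (X.glue t k).map fun b => (some b.1, b.2)

theorem layerGlue_some (T : X.OneVertexTorus) {t t' : X.Tet} {k : Fin 4} {σ : Perm (Fin 4)}
    (h : X.glue t k = some (t', σ)) : layerGlue T (some t) k = some (some t', σ) := by
  have hp : (t, k) ≠ T.p.face := by
    intro e
    have := T.boundary_p
    rw [← e, IsBoundary, h] at this
    exact absurd this (by simp)
  have hq : (t, k) ≠ T.q.face := by
    intro e
    have := T.boundary_q
    rw [← e, IsBoundary, h] at this
    exact absurd this (by simp)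
  simp [layerGlue, hp, hq, h]

/-- Layering a tetrahedron on the one-vertex torus `T` at its diagonal `z`. -/
noncomputable def layer (T : X.OneVertexTorus) : Triangulation where
  Tet := Option X.Tet
  finite := by
    have := X.finite
    infer_instance
  glue := layerGlue T
  glue_symm := by
    have hpq : (T.q.1, T.q.2 3) ≠ T.p.face := T.face_ne.symm
    rintro (_ | t) k (_ | t') σ h
    · simp only [layerGlue] at h
      split_ifs at h <;> simp at h
    · simp only [layerGlue] at h
      split_ifs at h with h1 h2
      · simp only [Option.some.injEq, Prod.mk.injEq] at h
        obtain ⟨rfl, rfl⟩ := h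
        subst h1
        simp [layerGlue, LFace.face]
      · simp only [Option.some.injEq, Prod.mk.injEq] at h
        obtain ⟨rfl, rfl⟩ := h
        subst h2
        have e : (T.q.2 * swap 1 3 : Perm (Fin 4)) 1 = T.q.2 3 := by simp
        rw [e]
        change layerGlue T (some T.q.1) (T.q.2 3) = _
        rw [layerGlue, if_neg hpq, if_pos (by rfl)]
    · simp only [layerGlue] at h
      split_ifs at h with h1 h2
      · simp only [Option.some.injEq, Prod.mk.injEq, true_and] at h
        subst h
        simp only [LFace.face, Prod.mk.injEq] at h1
        obtain ⟨rfl, rfl⟩ := h1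
        simp [layerGlue]
      · simp only [Option.some.injEq, Prod.mk.injEq, true_and] at h
        subst h
        simp only [LFace.face, Prod.mk.injEq] at h2
        obtain ⟨rfl, rfl⟩ := h2
        simp [layerGlue]
      · simp at h
    · have h' : X.glue t k = some (t', σ) := by
        simp only [layerGlue] at h
        split_ifs at h with h1 h2
        · simp at h
        · simp at h
        · simpa [Option.map_eq_some_iff] using h
      exact layerGlue_some T (X.glue_symm _ _ _ _ h')
  glue_ne := by
    rintro (_ | t) k (_ | t') σ h
    · simp only [layerGlue] at h
      split_ifs at h <;> simp at h
    · simp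
    · simp
    · have h' : X.glue t k = some (t', σ) := by
        simp only [layerGlue] at h
        split_ifs at h with h1 h2
        · simp at h
        · simp at h
        · simpa [Option.map_eq_some_iff] using h
      have := X.glue_ne _ _ _ _ h'
      simpa using this

theorem layer_glue_some (T : X.OneVertexTorus) (t : X.Tet) (k : Fin 4) (t' : X.Tet)
    (σ : Perm (Fin 4)) (h : X.glue t k = some (t', σ)) :
    (layer T).glue (some t) k = some (some t', σ) :=
  layerGlue_some T h

/-- The lower side `ABC` of the new tetrahedron lies on `p`. -/
theorem layer_edge_p (T : X.OneVertexTorus) (a b : Fin 4) (ha : a ≠ 3) (hb : b ≠ 3) :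
    (layer T).EdgeEqv (none, a, b) (some T.p.1, T.p.2 a, T.p.2 b) :=
  .rel _ _ ⟨3, T.p.2, ha.symm, hb.symm, by simp [layer, layerGlue], rfl⟩

/-- The lower side `AEC` of the new tetrahedron lies on `q`. -/
theorem layer_edge_q (T : X.OneVertexTorus) (a b : Fin 4) (ha : a ≠ 1) (hb : b ≠ 1) :
    (layer T).EdgeEqv (none, a, b) (some T.q.1, T.q.2 (swap 1 3 a), T.q.2 (swap 1 3 b)) :=
  .rel _ _ ⟨1, T.q.2 * swap 1 3, ha.symm, hb.symm, by simp [layer, layerGlue], rfl⟩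

/-- The torus `T` after layering: the upper faces of the new tetrahedron, cut by the diagonal from
`B` to `E`, with the labels `p = (B, A, E)` and `q = (B, C, E)`.  The new `x` is the old `-x`, the
new `y` is the old `y`, so that the new diagonal `z` is the other diagonal `y - x` of the
rectangle. -/
noncomputable def OneVertexTorus.layered (T : X.OneVertexTorus) : (layer T).OneVertexTorus where
  p := (none, swap 0 1 * swap 2 3)
  q := (none, swap 0 1 * swap 1 2 * swap 2 3)
  boundary_p := by
    change layerGlue T none 2 = none
    simp [layerGlue]
  boundary_q := by
    change layerGlue T none 0 = none
    simp [layerGlue]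
  face_ne := by
    intro h
    have h2 := congrArg Prod.snd h
    exact absurd h2 (by decide : ((swap 0 1 * swap 2 3 : Perm (Fin 4)) 3 ≠
      (swap 0 1 * swap 1 2 * swap 2 3 : Perm (Fin 4)) 3))
  edge_x := by
    change (layer T).EdgeEqv (none, 1, 0) (none, 2, 3)
    have h1 := layer_edge_p T 1 0 (by decide) (by decide)
    have h2 := layer_edge_q T 2 3 (by decide) (by decide)
    have h3 := (T.edge_x.reverse).map (Y := layer T) some (layer_glue_some T)
    exact (h1.trans h3).trans h2.symm
  edge_y := by
    change (layer T).EdgeEqv (none, 0, 3) (none, 1, 2)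
    have h1 := layer_edge_p T 1 2 (by decide) (by decide)
    have h2 := layer_edge_q T 0 3 (by decide) (by decide)
    have h3 := T.edge_y.map (Y := layer T) some (layer_glue_some T)
    exact ((h1.trans h3).trans h2.symm).symm
  edge_z := by
    change (layer T).EdgeEqv (none, 1, 3) (none, 1, 3)
    exact Relation.EqvGen.refl _

/-- Another boundary torus `S` is not changed by layering on `T`. -/
noncomputable def OneVertexTorus.lift (S T : X.OneVertexTorus) (h : Disjoint T.faces S.faces) :
    (layer T).OneVertexTorus where
  p := (some S.p.1, S.p.2)
  q := (some S.q.1, S.q.2)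
  boundary_p := by
    have h1 : S.p.face ≠ T.p.face := fun e =>
      Set.disjoint_left.1 h (Or.inl rfl : T.p.face ∈ T.faces) (Or.inl e.symm)
    have h2 : S.p.face ≠ T.q.face := fun e =>
      Set.disjoint_left.1 h (Or.inr rfl : T.q.face ∈ T.faces) (Or.inl e.symm)
    have h3 : X.glue S.p.1 (S.p.2 3) = none := S.boundary_p
    change layerGlue T (some S.p.1) (S.p.2 3) = none
    change (S.p.1, S.p.2 3) ≠ _ at h1 h2
    simp [layerGlue, h1, h2, h3]
  boundary_q := by
    have h1 : S.q.face ≠ T.p.face := fun e =>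
      Set.disjoint_left.1 h (Or.inl rfl : T.p.face ∈ T.faces) (Or.inr e.symm)
    have h2 : S.q.face ≠ T.q.face := fun e =>
      Set.disjoint_left.1 h (Or.inr rfl : T.q.face ∈ T.faces) (Or.inr e.symm)
    have h3 : X.glue S.q.1 (S.q.2 3) = none := S.boundary_q
    change layerGlue T (some S.q.1) (S.q.2 3) = none
    change (S.q.1, S.q.2 3) ≠ _ at h1 h2
    simp [layerGlue, h1, h2, h3]
  face_ne := by
    intro e
    have h1 : S.p.1 = S.q.1 := Option.some_injective _ (congrArg Prod.fst e)
    have h2 : S.p.2 3 = S.q.2 3 := congrArg Prod.snd e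
    exact S.face_ne (Prod.ext h1 h2)
  edge_x := S.edge_x.map (Y := layer T) some (layer_glue_some T)
  edge_y := S.edge_y.map (Y := layer T) some (layer_glue_some T)
  edge_z := S.edge_z.map (Y := layer T) some (layer_glue_some T)

/-! ### Gluing two boundary tori -/

open Classical in
/-- The face gluings after the tori `T₀`, `T₁` are glued by the simplicial isomorphism that
respects the labels. -/
noncomputable def torusGlue (T₀ T₁ : X.OneVertexTorus) (t : X.Tet) (k : Fin 4) :
    Option (X.Tet × Perm (Fin 4)) :=
  if (t, k) = T₀.p.face then some (T₁.p.1, T₁.p.2 * T₀.p.2⁻¹)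
  else if (t, k) = T₀.q.face then some (T₁.q.1, T₁.q.2 * T₀.q.2⁻¹)
  else if (t, k) = T₁.p.face then some (T₀.p.1, T₀.p.2 * T₁.p.2⁻¹)
  else if (t, k) = T₁.q.face then some (T₀.q.1, T₀.q.2 * T₁.q.2⁻¹)
  else X.glue t k

theorem torusGlue_cases (T₀ T₁ : X.OneVertexTorus) (h : Disjoint T₀.faces T₁.faces) :
    torusGlue T₀ T₁ T₀.p.1 (T₀.p.2 3) = some (T₁.p.1, T₁.p.2 * T₀.p.2⁻¹) ∧
    torusGlue T₀ T₁ T₀.q.1 (T₀.q.2 3) = some (T₁.q.1, T₁.q.2 * T₀.q.2⁻¹) ∧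
    torusGlue T₀ T₁ T₁.p.1 (T₁.p.2 3) = some (T₀.p.1, T₀.p.2 * T₁.p.2⁻¹) ∧
    torusGlue T₀ T₁ T₁.q.1 (T₁.q.2 3) = some (T₀.q.1, T₀.q.2 * T₁.q.2⁻¹) := by
  have h0 : (T₀.q.1, T₀.q.2 3) ≠ T₀.p.face := T₀.face_ne.symm
  have h1 : (T₁.q.1, T₁.q.2 3) ≠ T₁.p.face := T₁.face_ne.symm
  have hpp : (T₁.p.1, T₁.p.2 3) ≠ T₀.p.face := fun e =>
    Set.disjoint_left.1 h (Or.inl rfl : T₀.p.face ∈ T₀.faces) (Or.inl e.symm)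
  have hpq : (T₁.p.1, T₁.p.2 3) ≠ T₀.q.face := fun e =>
    Set.disjoint_left.1 h (Or.inr rfl : T₀.q.face ∈ T₀.faces) (Or.inl e.symm)
  have hqp : (T₁.q.1, T₁.q.2 3) ≠ T₀.p.face := fun e =>
    Set.disjoint_left.1 h (Or.inl rfl : T₀.p.face ∈ T₀.faces) (Or.inr e.symm)
  have hqq : (T₁.q.1, T₁.q.2 3) ≠ T₀.q.face := fun e =>
    Set.disjoint_left.1 h (Or.inr rfl : T₀.q.face ∈ T₀.faces) (Or.inr e.symm)
  refine ⟨?_, ?_, ?_, ?_⟩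
  · rw [torusGlue, if_pos (by rfl)]
  · rw [torusGlue, if_neg h0, if_pos (by rfl)]
  · rw [torusGlue, if_neg hpp, if_neg hpq, if_pos (by rfl)]
  · rw [torusGlue, if_neg hqp, if_neg hqq, if_neg h1, if_pos (by rfl)]

/-- Gluing the boundary tori `T₀` and `T₁` of `X` by the simplicial isomorphism that respects
the labels. -/
noncomputable def glueTori (T₀ T₁ : X.OneVertexTorus) (h : Disjoint T₀.faces T₁.faces) :
    Triangulation where
  Tet := X.Tet
  finite := X.finite
  glue := torusGlue T₀ T₁
  glue_symm := by
    obtain ⟨c1, c2, c3, c4⟩ := torusGlue_cases T₀ T₁ h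
    intro t k t' σ e
    rw [torusGlue] at e
    split_ifs at e with e1 e2 e3 e4
    · simp only [LFace.face, Prod.mk.injEq] at e1
      simp only [Option.some.injEq, Prod.mk.injEq] at e
      obtain ⟨rfl, rfl⟩ := e1
      obtain ⟨rfl, rfl⟩ := e
      simpa using c3
    · simp only [LFace.face, Prod.mk.injEq] at e2
      simp only [Option.some.injEq, Prod.mk.injEq] at e
      obtain ⟨rfl, rfl⟩ := e2
      obtain ⟨rfl, rfl⟩ := e
      simpa using c4
    · simp only [LFace.face, Prod.mk.injEq] at e3
      simp only [Option.some.injEq, Prod.mk.injEq] at e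
      obtain ⟨rfl, rfl⟩ := e3
      obtain ⟨rfl, rfl⟩ := e
      simpa using c1
    · simp only [LFace.face, Prod.mk.injEq] at e4
      simp only [Option.some.injEq, Prod.mk.injEq] at e
      obtain ⟨rfl, rfl⟩ := e4
      obtain ⟨rfl, rfl⟩ := e
      simpa using c2
    · have e' := X.glue_symm _ _ _ _ e
      have hb : ∀ f : X.Tet × Fin 4, X.IsBoundary f → (t', σ k) ≠ f := by
        rintro f hf rfl
        rw [IsBoundary, e'] at hf
        exact absurd hf (by simp)
      rw [torusGlue, if_neg (hb _ T₀.boundary_p), if_neg (hb _ T₀.boundary_q),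
        if_neg (hb _ T₁.boundary_p), if_neg (hb _ T₁.boundary_q), e']
  glue_ne := by
    intro t k t' σ e
    rw [torusGlue] at e
    split_ifs at e with e1 e2 e3 e4
    · rw [e1]
      simp only [LFace.face, Prod.mk.injEq] at e1
      simp only [Option.some.injEq, Prod.mk.injEq] at e
      obtain ⟨rfl, rfl⟩ := e1
      obtain ⟨rfl, rfl⟩ := e
      intro e5
      exact Set.disjoint_left.1 h (Or.inl rfl : T₀.p.face ∈ T₀.faces)
        (Or.inl (by rw [← e5]; simp [LFace.face]))
    · rw [e2]
      simp only [LFace.face, Prod.mk.injEq] at e2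
      simp only [Option.some.injEq, Prod.mk.injEq] at e
      obtain ⟨rfl, rfl⟩ := e2
      obtain ⟨rfl, rfl⟩ := e
      intro e5
      exact Set.disjoint_left.1 h (Or.inr rfl : T₀.q.face ∈ T₀.faces)
        (Or.inr (by rw [← e5]; simp [LFace.face]))
    · rw [e3]
      simp only [LFace.face, Prod.mk.injEq] at e3
      simp only [Option.some.injEq, Prod.mk.injEq] at e
      obtain ⟨rfl, rfl⟩ := e3
      obtain ⟨rfl, rfl⟩ := e
      intro e5
      exact Set.disjoint_left.1 h (Or.inl rfl : T₀.p.face ∈ T₀.faces)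
        (Or.inl (by rw [LFace.face, LFace.face, ← show _ = (T₁.p.1, T₁.p.2 3) from e5]; simp))
    · rw [e4]
      simp only [LFace.face, Prod.mk.injEq] at e4
      simp only [Option.some.injEq, Prod.mk.injEq] at e
      obtain ⟨rfl, rfl⟩ := e4
      obtain ⟨rfl, rfl⟩ := e
      intro e5
      exact Set.disjoint_left.1 h (Or.inr rfl : T₀.q.face ∈ T₀.faces)
        (Or.inr (by rw [LFace.face, LFace.face, ← show _ = (T₁.q.1, T₁.q.2 3) from e5]; simp))
    · exact X.glue_ne _ _ _ _ e

end Triangulation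

/-! ### Slopes and the Farey graph -/

/-- The first homology of a torus with a chosen basis.  For a labelled one-vertex torus the basis
is `(x, y)`: the cellular chain complex has one vertex, the three edges `x, y, z`, and two faces
with boundary `x + y - z` up to sign, so that the homology is free on `x` and `y`. -/
abbrev H1 : Type := ℤ × ℤ

/-- Homology classes of simple closed essential curves: those with coprime coordinates. -/
abbrev PrimitiveClass : Type := {v : H1 // IsCoprime v.1 v.2}

/-- Forgetting the orientation of a curve. -/
def slopeSetoid : Setoid PrimitiveClass where
  r v w := v.1 = w.1 ∨ v.1 = -w.1
  iseqv :=
    { refl := fun _ => Or.inl rfl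
      symm := by
        rintro v w (h | h)
        · exact Or.inl h.symm
        · exact Or.inr (by rw [h, neg_neg])
      trans := by
        rintro u v w (h | h) (h' | h')
        · exact Or.inl (h.trans h')
        · exact Or.inr (h.trans h')
        · exact Or.inr (by rw [h, h'])
        · exact Or.inl (by rw [h, h', neg_neg]) }

/-- A slope of a torus with a chosen homology basis: a pair of coprime integers up to a common
sign, that is, an extended rational. -/
def Slope : Type := Quotient slopeSetoid

/-- The Farey graph: two slopes are adjacent if `|ad - bc| = 1`. -/
def fareyGraph : SimpleGraph Slope where
  Adj s t := ∃ v w : PrimitiveClass, s = Quotient.mk _ v ∧ t = Quotient.mk _ w ∧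
    |v.1.1 * w.1.2 - v.1.2 * w.1.1| = 1
  symm := ⟨by
    rintro s t ⟨v, w, hs, ht, h⟩
    refine ⟨w, v, ht, hs, ?_⟩
    rw [← h, ← abs_neg]
    congr 1
    ring⟩
  loopless := ⟨by
    rintro s ⟨v, w, hs, ht, h⟩
    have h2 : slopeSetoid v w := Quotient.exact (hs.symm.trans ht)
    rcases h2 with h2 | h2
    · rw [h2] at h
      have : w.1.1 * w.1.2 - w.1.2 * w.1.1 = 0 := by ring
      rw [this] at h
      simp at h
    · rw [h2] at h
      have : (-w.1).1 * w.1.2 - (-w.1).2 * w.1.1 = 0 := by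
        simp only [Prod.fst_neg, Prod.snd_neg]
        ring
      rw [this] at h
      simp at h⟩

theorem isCoprime_map (φ : H1 ≃+ H1) (v : H1) (h : IsCoprime v.1 v.2) :
    IsCoprime (φ v).1 (φ v).2 := by
  obtain ⟨a, b, hab⟩ := h
  have key : ∀ w : H1, φ.symm w = w.1 • φ.symm (1, 0) + w.2 • φ.symm (0, 1) := by
    intro w
    rw [← map_zsmul, ← map_zsmul, ← map_add]
    congr 1
    ext <;> simp
  have hv := key (φ v)
  rw [AddEquiv.symm_apply_apply] at hv
  have h1 := congrArg Prod.fst hv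
  have h2 := congrArg Prod.snd hv
  simp only [Prod.fst_add, Prod.snd_add, Prod.smul_fst, Prod.smul_snd, smul_eq_mul] at h1 h2
  generalize φ.symm (1, 0) = r at h1 h2
  generalize φ.symm (0, 1) = s at h1 h2
  refine ⟨a * r.1 + b * r.2, a * s.1 + b * s.2, ?_⟩
  linear_combination hab - a * h1 - b * h2

/-- The action on slopes of an isomorphism of first homology groups. -/
def Slope.map (φ : H1 ≃+ H1) : Slope → Slope :=
  Quotient.map (fun v : PrimitiveClass => ⟨φ v.1, isCoprime_map φ v.1 v.2⟩) (by
    rintro v w (h | h)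
    · exact Or.inl (congrArg φ h)
    · exact Or.inr (by simp [h]))

/-! ### Layering on one of two boundary tori, then gluing them -/

/-- A triangulation together with two different one-vertex torus boundary components. -/
structure TorusPair where
  X : Triangulation
  T₀ : X.OneVertexTorus
  T₁ : X.OneVertexTorus
  disjoint : Disjoint T₀.faces T₁.faces

namespace TorusPair

open Triangulation

/-- Change of the labels of `T₀`: the new `x, y` are `y, -(x + y)`. -/
def rotate (P : TorusPair) : TorusPair := ⟨P.X, P.T₀.rotate, P.T₁, P.disjoint⟩

/-- Change of the labels of `T₀`: the new `x, y` are `y, x`. -/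
def exchange (P : TorusPair) : TorusPair :=
  ⟨P.X, P.T₀.exchange, P.T₁, by
    have : P.T₀.exchange.faces = P.T₀.faces := Set.pair_comm _ _
    rw [this]
    exact P.disjoint⟩

/-- Change of the labels of `T₀`: the new `x, y` are `-y, -x`. -/
def reverse (P : TorusPair) : TorusPair := ⟨P.X, P.T₀.reverse, P.T₁, P.disjoint⟩

/-- Layering one tetrahedron on `T₀`, at its diagonal. -/
noncomputable def layer (P : TorusPair) : TorusPair where
  X := Triangulation.layer P.T₀
  T₀ := P.T₀.layered
  T₁ := P.T₁.lift P.T₀ P.disjoint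
  disjoint := by
    rw [Set.disjoint_left]
    rintro f (rfl | rfl) (h | h)
    all_goals
      exact Option.some_ne_none _ (congrArg Prod.fst h).symm

/-- Gluing `T₀` to `T₁` by the simplicial isomorphism that respects the labels. -/
noncomputable def glue (P : TorusPair) : Triangulation := glueTori P.T₀ P.T₁ P.disjoint

/-- `a x' + b y' = a y - b (x + y)` for the labels `x', y'` after `rotate`. -/
def rotateH1 : H1 ≃+ H1 where
  toFun v := (-v.2, v.1 - v.2)
  invFun v := (v.2 - v.1, -v.1)
  left_inv v := by ext <;> simp
  right_inv v := by ext <;> simp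
  map_add' v w := by ext <;> simp <;> ring

/-- `a x' + b y' = a y + b x` for the labels `x', y'` after `exchange`. -/
def exchangeH1 : H1 ≃+ H1 where
  toFun v := (v.2, v.1)
  invFun v := (v.2, v.1)
  left_inv _ := rfl
  right_inv _ := rfl
  map_add' _ _ := rfl

/-- `a x' + b y' = -a y - b x` for the labels `x', y'` after `reverse`. -/
def reverseH1 : H1 ≃+ H1 where
  toFun v := (-v.2, -v.1)
  invFun v := (-v.2, -v.1)
  left_inv v := by ext <;> simp
  right_inv v := by ext <;> simp
  map_add' v w := by ext <;> simp <;> ring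

/-- `a x' + b y' = -a x + b y` for the labels `x', y'` after `layer` (the sides of the rectangle
stay in the torus, its diagonal is flipped). -/
def layerH1 : H1 ≃+ H1 where
  toFun v := (-v.1, v.2)
  invFun v := (-v.1, v.2)
  left_inv v := by ext <;> simp
  right_inv v := by ext <;> simp
  map_add' v w := by ext <;> simp <;> ring

/-- `P.LayersTo n Q φ`: `Q` arises from `P` by layering `n` tetrahedra on the torus `T₀`, each at
any of the three edges of the current triangulation of the torus (and by changing labels), and
`φ` is the resulting identification of the homology of `Q.T₀`, in its labels, with that of
`P.T₀`, in its labels. -/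
inductive LayersTo (P : TorusPair) : ℕ → TorusPair → (H1 ≃+ H1) → Prop
  | refl : LayersTo P 0 P (AddEquiv.refl H1)
  | rotate {n : ℕ} {Q : TorusPair} {φ : H1 ≃+ H1} (h : LayersTo P n Q φ) :
      LayersTo P n Q.rotate (rotateH1.trans φ)
  | exchange {n : ℕ} {Q : TorusPair} {φ : H1 ≃+ H1} (h : LayersTo P n Q φ) :
      LayersTo P n Q.exchange (exchangeH1.trans φ)
  | reverse {n : ℕ} {Q : TorusPair} {φ : H1 ≃+ H1} (h : LayersTo P n Q φ) :
      LayersTo P n Q.reverse (reverseH1.trans φ)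
  | layer {n : ℕ} {Q : TorusPair} {φ : H1 ≃+ H1} (h : LayersTo P n Q φ) :
      LayersTo P (n + 1) Q.layer (layerH1.trans φ)

end TorusPair

/-! ### Equivalence relations generated by symmetric steps -/

/-! The proof has a topological half (layering and gluing preserve manifolds and orientability) and
an arithmetic half (suitable layerings push slopes apart in the Farey graph).

Topology. Turning around an edge from a boundary face is a deterministic process that ends only at a
boundary face, so at most two boundary faces meet at an edge (`boundary_unique`), and they have
opposite signs in any orientation (`sgn_eq_neg`). Hence the six corners of a one-vertex torus are
closed under adjacency in the boundary of the link of its vertex. Since that link is a disc, they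
are its whole boundary (`linkBoundary_eq`), and different tori have different vertices
(`not_vertexEqv_base`). Layering leaves the Euler characteristic of the link unchanged: it adds 2
vertices, 6 edges and 4 triangles, and 2 - 6 + 4 = 0 (`linkEuler_layer`). Gluing two tori joins two
discs along a circle with 6 vertices and 6 edges, and 1 + 1 - 6 + 6 = 2 (`linkEuler_glueTori`).
Orientability survives the gluing if the matched faces have opposite signs; exchanging the two faces
of one torus achieves this if necessary (`compatible_or_exchange`).

Arithmetic. Let the sign of a slope ±(a,b) be the sign of ab. The Farey edge from x to y separates
positive from negative slopes: a neighbour of a negative slope is never positive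
(`Slope.prod_nonpos_of_adj`). A rotation of the labels followed by a layering changes coordinates by
F(a,b) = -(b, a+b). F keeps positive slopes positive, and the square of its inverse makes all
nonpositive slopes negative. So a path from a nonpositive slope to F^(2n) t, with t positive, can be
pulled back two flips at a time, at the cost of at least one edge each time (`lt_length_of_nonpos`).
If the path starts at a negative slope, one more edge is needed (`lt_edist_of_neg`). Labels are
chosen with α₀ positive, the first flip makes it negative, and the remaining 2D - 1 flips act by F.
The final labels, which fix the gluing map, are chosen to make α₁ positive without spoiling the
orientation. For D = 0 the gluing map alone separates the slopes. -/

/-- Symmetry of the steps turns an invariant that is checked only forwards into an equivalence,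
which is what an induction through `symm` needs. -/
theorem Relation.EqvGen.imp_of_step {α : Type*} {r : α → α → Prop}
    (hs : ∀ a b, r a b → r b a) {P : α → Prop} (hP : ∀ a b, r a b → P a → P b)
    {a b : α} (h : Relation.EqvGen r a b) : P a → P b := by
  have key : P a ↔ P b := by
    induction h with
    | rel a b h => exact ⟨hP _ _ h, hP _ _ (hs _ _ h)⟩
    | refl a => exact Iff.rfl
    | symm a b _ ih => exact ih.symm
    | trans a b c _ _ ih1 ih2 => exact ih1.trans ih2
  exact key.1

namespace Fin

theorem exists_perm_of_ne : ∀ i j k : Fin 4, i ≠ j → i ≠ k → j ≠ k →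
    ∃ π : Perm (Fin 4), π 0 = i ∧ π 1 = j ∧ π 3 = k := by decide

theorem perm_eq_one_or_swap : ∀ ρ : Perm (Fin 4), ρ 0 = 0 → ρ 1 = 1 → ρ = 1 ∨ ρ = swap 2 3 := by
  decide

theorem eq_two_or_three : ∀ c : Fin 4, c ≠ 0 → c ≠ 1 → c = 2 ∨ c = 3 := by decide

end Fin

/-! ### Identifications of vertices, edges and corners -/

namespace Triangulation

variable {X : Triangulation}

theorem VertexStep.symm {a b : X.Tet × Fin 4} (h : X.VertexStep a b) : X.VertexStep b a := by
  obtain ⟨k, σ, hk, hg, hb⟩ := h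
  refine ⟨σ k, σ⁻¹, ?_, X.glue_symm _ _ _ _ hg, by simp [hb]⟩
  rw [hb]
  exact fun e => hk (σ.injective e)

theorem EdgeStep.symm {a b : X.Tet × Fin 4 × Fin 4} (h : X.EdgeStep a b) : X.EdgeStep b a := by
  obtain ⟨k, σ, hk, hk', hg, hb⟩ := h
  refine ⟨σ k, σ⁻¹, ?_, ?_, X.glue_symm _ _ _ _ hg, by simp [hb]⟩
  · rw [hb]
    exact fun e => hk (σ.injective e)
  · rw [hb]
    exact fun e => hk' (σ.injective e)

theorem CornerStep.symm {a b : X.Tet × Fin 4 × Fin 4} (h : X.CornerStep a b) :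
    X.CornerStep b a := by
  obtain ⟨σ, hg, hb⟩ := h
  refine ⟨σ⁻¹, ?_, by simp [hb]⟩
  rw [hb]
  exact X.glue_symm _ _ _ _ hg

theorem VertexEqv.refl (a : X.Tet × Fin 4) : X.VertexEqv a a := Relation.EqvGen.refl _

theorem VertexEqv.symm {a b : X.Tet × Fin 4} (h : X.VertexEqv a b) : X.VertexEqv b a :=
  Relation.EqvGen.symm _ _ h

theorem VertexEqv.trans {a b c : X.Tet × Fin 4} (h : X.VertexEqv a b) (h' : X.VertexEqv b c) :
    X.VertexEqv a c :=
  Relation.EqvGen.trans _ _ _ h h'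

theorem EdgeEqv.refl (a : X.Tet × Fin 4 × Fin 4) : X.EdgeEqv a a := Relation.EqvGen.refl _

/-- Identified edges have identified initial vertices. -/
theorem EdgeEqv.vertexEqv {a b : X.Tet × Fin 4 × Fin 4} (h : X.EdgeEqv a b) :
    X.VertexEqv (a.1, a.2.1) (b.1, b.2.1) := by
  have key : ∀ a b, Relation.EqvGen X.EdgeStep a b →
      Relation.EqvGen X.VertexStep (a.1, a.2.1) (b.1, b.2.1) := by
    intro a b hab
    induction hab with
    | rel a b h =>
      obtain ⟨k, σ, h1, h2, h3, h4⟩ := h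
      exact .rel _ _ ⟨k, σ, h1, h3, by simp [h4]⟩
    | refl a => exact .refl _
    | symm a b _ ih => exact .symm _ _ ih
    | trans a b c _ _ ih1 ih2 => exact .trans _ _ _ ih1 ih2
  exact key _ _ h

/-- Identified vertices are identified degenerate edges. -/
theorem VertexEqv.edgeEqv {a b : X.Tet × Fin 4} (h : X.VertexEqv a b) :
    X.EdgeEqv (a.1, a.2, a.2) (b.1, b.2, b.2) := by
  have key : ∀ a b, Relation.EqvGen X.VertexStep a b →
      Relation.EqvGen X.EdgeStep (a.1, a.2, a.2) (b.1, b.2, b.2) := by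
    intro a b hab
    induction hab with
    | rel a b h =>
      obtain ⟨k, σ, h1, h3, h4⟩ := h
      exact .rel _ _ ⟨k, σ, h1, h1, h3, by simp [h4]⟩
    | refl a => exact .refl _
    | symm a b _ ih => exact .symm _ _ ih
    | trans a b c _ _ ih1 ih2 => exact .trans _ _ _ ih1 ih2
  exact key _ _ h

/-- At most two corners of faces are identified. -/
theorem cornerSetoid_iff {a b : X.Tet × Fin 4 × Fin 4} :
    X.cornerSetoid a b ↔ a = b ∨ X.CornerStep a b := by
  constructor
  · intro h
    refine Relation.EqvGen.imp_of_step (r := X.CornerStep) (P := fun c => a = c ∨ X.CornerStep a c)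
      (fun _ _ => CornerStep.symm) ?_ h (Or.inl rfl)
    rintro c d hcd (rfl | hac)
    · exact Or.inr hcd
    · left
      obtain ⟨σ, hg, hb⟩ := hac.symm
      obtain ⟨τ, hg', hb'⟩ := hcd
      rw [hg] at hg'
      simp only [Option.some.injEq, Prod.mk.injEq] at hg'
      obtain ⟨h1, rfl⟩ := hg'
      exact Prod.ext h1 (hb.trans hb'.symm)
  · rintro (rfl | h)
    · exact Relation.EqvGen.refl _
    · exact Relation.EqvGen.rel _ _ h

/-! ### The boundary faces at an edge -/

/-- The same edge, with the other face of the tetrahedron at this edge. -/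
def LFace.turn (l : X.LFace) : X.LFace := l.relabel (swap 2 3)

@[simp] theorem LFace.turn_turn (l : X.LFace) : l.turn.turn = l := by
  simp [LFace.turn, LFace.relabel, mul_assoc]

/-- Turning around the edge `l.edge 0 1`: from a face through a tetrahedron to its other face at
this edge, and across that face. -/
def FlagStep (X : Triangulation) (l m : X.LFace) : Prop :=
  ∃ t' σ, X.glue l.1 (l.2 2) = some (t', σ) ∧ m = (t', σ * l.2 * swap 2 3)

theorem FlagStep.glue_eq {l m : X.LFace} (h : X.FlagStep l m) :
    ∃ τ : Perm (Fin 4), X.glue m.1 (m.2 3) = some (l.1, τ⁻¹) ∧ m.2 = τ * l.2 * swap 2 3 := by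
  obtain ⟨t', σ, hg, rfl⟩ := h
  exact ⟨σ, by simpa using X.glue_symm _ _ _ _ hg, rfl⟩

theorem FlagStep.rightUnique : Relator.RightUnique X.FlagStep := by
  rintro l m n ⟨t, σ, h, rfl⟩ ⟨t', σ', h', rfl⟩
  rw [h] at h'
  simp only [Option.some.injEq, Prod.mk.injEq] at h'
  obtain ⟨rfl, rfl⟩ := h'
  rfl

/-- The set of flags passed when turning from a boundary face is closed under face gluings. -/
theorem reach_glue {l n : X.LFace} {t' : X.Tet} {σ : Perm (Fin 4)} (hl : X.IsBoundary l.face)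
    (hg : X.glue n.1 (n.2 3) = some (t', σ))
    (h : Relation.ReflTransGen X.FlagStep l n ∨ Relation.ReflTransGen X.FlagStep l n.turn) :
    Relation.ReflTransGen X.FlagStep l (t', σ * n.2) ∨
      Relation.ReflTransGen X.FlagStep l (LFace.turn (t', σ * n.2)) := by
  rcases h with h | h
  · right
    rcases h.cases_tail with rfl | ⟨n', hn', hs⟩
    · change X.glue n.1 (n.2 3) = none at hl
      rw [hl] at hg
      simp at hg
    · obtain ⟨τ, h1, h2⟩ := hs.glue_eq
      rw [hg] at h1
      simp only [Option.some.injEq, Prod.mk.injEq] at h1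
      obtain ⟨rfl, rfl⟩ := h1
      have : LFace.turn (n'.1, τ⁻¹ * n.2) = n' := by
        simp [LFace.turn, LFace.relabel, h2, mul_assoc]
      rwa [this]
  · left
    refine h.tail ⟨t', σ, ?_, ?_⟩
    · simpa [LFace.turn, LFace.relabel] using hg
    · simp [LFace.turn, LFace.relabel, mul_assoc]

/-- A flag is determined by its tetrahedron and oriented edge up to `turn`. Therefore the invariant
speaks of all flags `m` at the current edge and leaves open which of `m`, `m.turn` is reached. -/
theorem reach_of_edgeEqv {l m : X.LFace} (hl : X.IsBoundary l.face)
    (h : X.EdgeEqv (l.edge 0 1) (m.edge 0 1)) :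
    Relation.ReflTransGen X.FlagStep l m ∨ Relation.ReflTransGen X.FlagStep l m.turn := by
  refine Relation.EqvGen.imp_of_step (r := X.EdgeStep) (P := fun e => ∀ m : X.LFace,
    m.edge 0 1 = e → Relation.ReflTransGen X.FlagStep l m ∨
      Relation.ReflTransGen X.FlagStep l m.turn) (fun _ _ => EdgeStep.symm) ?_ h ?_ m rfl
  · rintro ⟨t, i, j⟩ ⟨t', e⟩ ⟨k, σ, hi, hj, hg, he⟩ ih m hm
    simp only [LFace.edge, Prod.mk.injEq] at he hm hi hj hg
    obtain ⟨rfl, he'⟩ := hm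
    rw [he, Prod.mk.injEq] at he'
    have hn := ih (t, σ⁻¹ * m.2) (by simp [LFace.edge, he'])
    -- The glued face contains the edge, so its opposite vertex has position 2 or 3 in the flag: the
    -- gluing is across the face of the turned flag or of the flag itself.
    have hk : k = (σ⁻¹ * m.2) ((σ⁻¹ * m.2)⁻¹ k) := by simp
    generalize hc : (σ⁻¹ * m.2)⁻¹ k = c at hk
    have h0 : c ≠ 0 := by
      rintro rfl
      exact hi (by rw [hk]; simp [he'.1])
    have h1 : c ≠ 1 := by
      rintro rfl
      exact hj (by rw [hk]; simp [he'.2])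
    rcases Fin.eq_two_or_three c h0 h1 with rfl | rfl
    · have := reach_glue (n := LFace.turn (t, σ⁻¹ * m.2)) (t' := m.1) (σ := σ) hl
        (by rw [← hg, hk]; simp [LFace.turn, LFace.relabel]) (by rwa [LFace.turn_turn, or_comm])
      have e : ((m.1, σ * (LFace.turn (X := X) (t, σ⁻¹ * m.2)).2) : X.LFace) = m.turn := by
        simp [LFace.turn, LFace.relabel, ← mul_assoc]
      rw [e, LFace.turn_turn, or_comm] at this
      exact this
    · have := reach_glue (n := (t, σ⁻¹ * m.2)) (t' := m.1) (σ := σ) hl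
        (by rw [← hg, hk]) hn
      simpa using this
  · intro m hm
    simp only [LFace.edge, Prod.mk.injEq] at hm
    obtain ⟨h1, h2, h3⟩ := hm
    rcases Fin.perm_eq_one_or_swap (l.2⁻¹ * m.2) (by simp [h2]) (by simp [h3]) with e | e
    · left
      have : m = l := Prod.ext h1 (inv_mul_eq_one.1 e).symm
      rw [this]
    · right
      have : m.turn = l := by
        refine Prod.ext h1 ?_
        simp [LFace.turn, LFace.relabel, inv_mul_eq_iff_eq_mul.1 e, mul_assoc]
      rw [this]

/-- A flag entered by a `FlagStep` has a glued face, so a boundary flag `m` can be reached only as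
the starting point. -/
theorem eq_or_reach {l m : X.LFace} (hl : X.IsBoundary l.face) (hm : X.IsBoundary m.face)
    (h : X.EdgeEqv (l.edge 0 1) (m.edge 0 1)) :
    m = l ∨ Relation.ReflTransGen X.FlagStep l m.turn := by
  refine (reach_of_edgeEqv hl h).imp_left fun h => ?_
  rcases h.cases_tail with h | ⟨n, _, hs⟩
  · exact h
  · obtain ⟨τ, h1, -⟩ := hs.glue_eq
    rw [show X.glue m.1 (m.2 3) = none from hm] at h1
    simp at h1

/-- The next step from `m.turn` would cross the boundary face of `m`, so turning stops there. -/
theorem eq_of_reach_turn {m n : X.LFace} (hm : X.IsBoundary m.face)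
    (h : Relation.ReflTransGen X.FlagStep m.turn n) : n = m.turn := by
  rcases h.cases_head with h | ⟨n', ⟨t, σ, hg, -⟩, _⟩
  · exact h.symm
  · have : X.glue m.1 (m.2 3) = some (t, σ) := by
      simpa [LFace.turn, LFace.relabel] using hg
    rw [show X.glue m.1 (m.2 3) = none from hm] at this
    simp at this

/-- At most two boundary faces meet at an edge. -/
theorem boundary_unique {l m n : X.LFace} (hl : X.IsBoundary l.face) (hm : X.IsBoundary m.face)
    (hn : X.IsBoundary n.face) (hlm : X.EdgeEqv (l.edge 0 1) (m.edge 0 1))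
    (hln : X.EdgeEqv (l.edge 0 1) (n.edge 0 1)) (h : m ≠ l) (h' : n ≠ l) : m = n := by
  have h1 := (eq_or_reach hl hm hlm).resolve_left h
  have h2 := (eq_or_reach hl hn hln).resolve_left h'
  have h3 : m.turn = n.turn := by
    rcases Relation.ReflTransGen.total_of_right_unique FlagStep.rightUnique h1 h2 with h | h
    · exact (eq_of_reach_turn hm h).symm
    · exact eq_of_reach_turn hn h
  simpa using congrArg LFace.turn h3

/-! ### Signs of boundary faces -/

/-- All face gluings are compatible with the orientation `o` of the tetrahedra. -/
def IsOrientation (X : Triangulation) (o : X.Tet → ℤˣ) : Prop :=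
  ∀ t k t' σ, X.glue t k = some (t', σ) → o t' = - (Perm.sign σ * o t)

/-- The sign of a labelled face with respect to an orientation of the tetrahedra. -/
def LFace.sgn (l : X.LFace) (o : X.Tet → ℤˣ) : ℤˣ := Perm.sign l.2 * o l.1

theorem LFace.sgn_relabel (l : X.LFace) (o : X.Tet → ℤˣ) (c : Perm (Fin 4)) :
    (l.relabel c).sgn o = Perm.sign c * l.sgn o := by
  simp only [LFace.sgn, LFace.relabel, Perm.sign_mul]
  rw [mul_comm (Perm.sign l.2), mul_assoc]

/-- The two boundary faces at an edge have opposite signs. -/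
theorem sgn_eq_neg {o : X.Tet → ℤˣ} (ho : X.IsOrientation o) {l m : X.LFace}
    (hl : X.IsBoundary l.face) (hm : X.IsBoundary m.face)
    (hlm : X.EdgeEqv (l.edge 0 1) (m.edge 0 1)) (h : m ≠ l) : m.sgn o = - l.sgn o := by
  have h1 := (eq_or_reach hl hm hlm).resolve_left h
  -- A step preserves the sign: the transposition in `FlagStep` cancels the minus sign in the
  -- orientation condition. The final `turn` then contributes the sign change.
  have key : ∀ n, Relation.ReflTransGen X.FlagStep l n → n.sgn o = l.sgn o := by
    intro n hn
    induction hn with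
    | refl => rfl
    | tail _ hs ih =>
      obtain ⟨t', σ, hg, rfl⟩ := hs
      rw [← ih]
      simp only [LFace.sgn, Perm.sign_mul, ho _ _ _ _ hg,
        Perm.sign_swap (show (2 : Fin 4) ≠ 3 by decide)]
      rcases Int.units_eq_one_or (Perm.sign σ) with e | e <;> simp [e]
  have h2 := key _ h1
  rw [LFace.turn, LFace.sgn_relabel, Perm.sign_swap (show (2 : Fin 4) ≠ 3 by decide)] at h2
  rw [← h2]
  simp

end Triangulation

namespace Triangulation

variable {X : Triangulation}

/-! ### One-vertex tori in the boundary -/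

namespace OneVertexTorus

variable (T : X.OneVertexTorus)

/-- The labelled faces of the torus. -/
def side (s : Bool) : X.LFace := bif s then T.q else T.p

theorem boundary_side (s : Bool) : X.IsBoundary (T.side s).face := by
  cases s
  · exact T.boundary_p
  · exact T.boundary_q

theorem side_face_ne (s : Bool) : (T.side !s).face ≠ (T.side s).face := by
  cases s
  · exact T.face_ne.symm
  · exact T.face_ne

theorem side_face_injective : Function.Injective fun s => (T.side s).face := by
  intro s s' h
  by_contra hs
  obtain rfl : s = !s' := by cases s <;> cases s' <;> simp_all
  exact T.side_face_ne _ h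

theorem mem_faces_iff {f : X.Tet × Fin 4} : f ∈ T.faces ↔ ∃ s, (T.side s).face = f := by
  simp [faces, side, eq_comm]

theorem side_mem_faces (s : Bool) : (T.side s).face ∈ T.faces := T.mem_faces_iff.2 ⟨s, rfl⟩

/-- The edge of the other face of a one-vertex torus that is identified with a given edge. -/
def mate (a b : Fin 4) : Fin 4 × Fin 4 :=
  if a = 0 ∧ b = 1 then (1, 2) else if a = 1 ∧ b = 2 then (0, 1) else
    if a = 1 ∧ b = 0 then (2, 1) else if a = 2 ∧ b = 1 then (1, 0) else (a, b)

theorem mate_ne : ∀ {a b : Fin 4}, a ≠ 3 → b ≠ 3 → a ≠ b →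
    (mate a b).1 ≠ 3 ∧ (mate a b).2 ≠ 3 ∧ (mate a b).1 ≠ (mate a b).2 := by
  decide

/-- Every edge of one of the two faces is identified with an edge of the other one. -/
theorem edgeEqv_mate (s : Bool) {a b : Fin 4} (ha : a ≠ 3) (hb : b ≠ 3) (hab : a ≠ b) :
    X.EdgeEqv ((T.side s).edge a b) ((T.side !s).edge (mate a b).1 (mate a b).2) := by
  cases s <;> fin_cases a <;> fin_cases b <;> first
    | exact absurd rfl ha
    | exact absurd rfl hb
    | exact absurd rfl hab
    | exact T.edge_x
    | exact T.edge_y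
    | exact T.edge_z
    | exact T.edge_x.symm
    | exact T.edge_y.symm
    | exact T.edge_z.symm
    | exact T.edge_x.reverse
    | exact T.edge_y.reverse
    | exact T.edge_z.reverse
    | exact T.edge_x.symm.reverse
    | exact T.edge_y.symm.reverse
    | exact T.edge_z.symm.reverse

theorem exists_edgeEqv_side (s : Bool) {a b : Fin 4} (ha : a ≠ 3) (hb : b ≠ 3) (hab : a ≠ b) :
    ∃ a' b', a' ≠ 3 ∧ b' ≠ 3 ∧ a' ≠ b' ∧
      X.EdgeEqv ((T.side s).edge a b) ((T.side !s).edge a' b') := by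
  obtain ⟨h1, h2, h3⟩ := mate_ne ha hb hab
  exact ⟨_, _, h1, h2, h3, T.edgeEqv_mate s ha hb hab⟩

theorem exists_flag (s : Bool) {a b : Fin 4} (ha : a ≠ 3) (hb : b ≠ 3) (hab : a ≠ b) :
    ∃ l : X.LFace, l.face = (T.side s).face ∧ l.edge 0 1 = (T.side s).edge a b := by
  obtain ⟨π, h0, h1, h3⟩ := Fin.exists_perm_of_ne a b 3 hab ha hb
  exact ⟨(T.side s).relabel π, by simp [LFace.relabel, LFace.face, h3],
    by simp [LFace.relabel, LFace.edge, h0, h1]⟩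

/-- The only boundary faces at an edge of the torus are the two faces of the torus. -/
theorem face_of_edgeEqv {s : Bool} {a b : Fin 4} (ha : a ≠ 3) (hb : b ≠ 3) (hab : a ≠ b)
    {m : X.LFace} (hm : X.IsBoundary m.face)
    (h : X.EdgeEqv ((T.side s).edge a b) (m.edge 0 1)) :
    (m.face = (T.side s).face ∧ m.edge 0 1 = (T.side s).edge a b) ∨
      m.face = (T.side !s).face := by
  obtain ⟨l, hl, hle⟩ := T.exists_flag s ha hb hab
  obtain ⟨a', b', ha', hb', hab', h'⟩ := T.exists_edgeEqv_side s ha hb hab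
  obtain ⟨n, hn, hne⟩ := T.exists_flag (!s) ha' hb' hab'
  by_cases hml : m = l
  · left
    rw [hml]
    exact ⟨hl, hle⟩
  · right
    have hnl : n ≠ l := by
      rintro rfl
      exact T.side_face_ne s (hn.symm.trans hl)
    rw [boundary_unique (by rw [hl]; exact T.boundary_side s) hm
      (by rw [hn]; exact T.boundary_side _) (by rwa [hle]) (by rwa [hle, hne]) hml hnl, hn]

/-- By `face_of_edgeEqv` a boundary flag at this edge that lies on the same face has this very edge.
Thus the three edges of the torus, and their reverses, are pairwise distinct. -/
theorem edge_injective {s : Bool} {a b a' b' : Fin 4} (ha : a ≠ 3) (hb : b ≠ 3) (hab : a ≠ b)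
    (ha' : a' ≠ 3) (hb' : b' ≠ 3) (hab' : a' ≠ b')
    (h : X.EdgeEqv ((T.side s).edge a b) ((T.side s).edge a' b')) : a = a' ∧ b = b' := by
  obtain ⟨m, hm, hme⟩ := T.exists_flag s ha' hb' hab'
  rcases T.face_of_edgeEqv ha hb hab (m := m) (by rw [hm]; exact T.boundary_side s)
    (by rwa [hme]) with h | h
  · have := h.2
    rw [hme] at this
    simp only [LFace.edge, Prod.mk.injEq, EmbeddingLike.apply_eq_iff_eq, true_and] at this
    exact ⟨this.1.symm, this.2.symm⟩
  · exact absurd (h.symm.trans hm) (T.side_face_ne s)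

theorem sgn_side {o : X.Tet → ℤˣ} (ho : X.IsOrientation o) : T.q.sgn o = - T.p.sgn o := by
  -- The faces are compared along the diagonal, which `swap 1 2` moves to positions 0 and 1;
  -- relabelling both faces leaves their relative sign unchanged.
  have h := sgn_eq_neg ho (l := T.p.relabel (swap 1 2)) (m := T.q.relabel (swap 1 2))
    T.boundary_p T.boundary_q T.edge_z
    (fun e => T.face_ne (congrArg LFace.face e).symm)
  rw [LFace.sgn_relabel, LFace.sgn_relabel, Perm.sign_swap (show (1 : Fin 4) ≠ 2 by decide)] at h
  simpa [neg_eq_iff_eq_neg] using h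

/-- The vertex of the torus. -/
def base : X.Tet × Fin 4 := (T.p.1, T.p.2 0)

theorem vertexEqv_base (s : Bool) {a : Fin 4} (ha : a ≠ 3) :
    X.VertexEqv ((T.side s).1, (T.side s).2 a) T.base := by
  have hx := T.edge_x.vertexEqv
  have hx' := T.edge_x.reverse.vertexEqv
  have hy := T.edge_y.vertexEqv
  have hy' := T.edge_y.reverse.vertexEqv
  have hz := T.edge_z.vertexEqv
  have hz' := T.edge_z.reverse.vertexEqv
  dsimp only [LFace.edge] at hx hx' hy hy' hz hz'
  have q0 : X.VertexEqv (T.q.1, T.q.2 0) T.base := hz.symm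
  have q1 : X.VertexEqv (T.q.1, T.q.2 1) T.base := hx.symm
  have p2 : X.VertexEqv (T.p.1, T.p.2 2) T.base := hy'.trans q1
  have p1 : X.VertexEqv (T.p.1, T.p.2 1) T.base := hy.trans q0
  have q2 : X.VertexEqv (T.q.1, T.q.2 2) T.base := hz'.symm.trans p2
  fin_cases a
  · cases s
    · exact .refl _
    · exact q0
  · cases s
    · exact p1
    · exact q1
  · cases s
    · exact p2
    · exact q2
  · exact absurd rfl ha

theorem vertexEqv_edge (s s' : Bool) {a a' : Fin 4} (ha : a ≠ 3) (ha' : a' ≠ 3) :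
    X.VertexEqv ((T.side s).1, (T.side s).2 a) ((T.side s').1, (T.side s').2 a') :=
  (T.vertexEqv_base s ha).trans (T.vertexEqv_base s' ha').symm

/-! ### The link of the vertex of a torus -/

/-- The corners of the faces of the torus. -/
def corners : Set (X.Tet × Fin 4 × Fin 4) := {c | c.2.1 ≠ c.2.2 ∧ (c.1, c.2.2) ∈ T.faces}

theorem mem_corners_iff {c : X.Tet × Fin 4 × Fin 4} :
    c ∈ T.corners ↔ ∃ s a, a ≠ 3 ∧ c = (T.side s).edge a 3 := by
  obtain ⟨t, i, k⟩ := c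
  simp only [corners, Set.mem_ofPred_eq, mem_faces_iff, LFace.face, LFace.edge, Prod.mk.injEq]
  constructor
  · rintro ⟨h, s, rfl, rfl⟩
    refine ⟨s, (T.side s).2⁻¹ i, ?_, rfl, by simp, rfl⟩
    rintro e
    exact h (by rw [← e]; simp)
  · rintro ⟨s, a, ha, rfl, rfl, rfl⟩
    exact ⟨fun e => ha ((T.side s).2.injective e), s, rfl, rfl⟩

theorem vertexEqv_of_mem_faces {t : X.Tet} {i k : Fin 4} (h : (t, k) ∈ T.faces) (hik : i ≠ k) :
    X.VertexEqv (t, i) T.base := by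
  obtain ⟨s, a, ha, h⟩ := T.mem_corners_iff.1 (show (t, i, k) ∈ T.corners from ⟨hik, h⟩)
  simp only [LFace.edge, Prod.mk.injEq] at h
  obtain ⟨rfl, rfl, rfl⟩ := h
  exact T.vertexEqv_base s ha

theorem boundary_of_mem_faces {f : X.Tet × Fin 4} (h : f ∈ T.faces) : X.IsBoundary f := by
  obtain ⟨s, rfl⟩ := T.mem_faces_iff.1 h
  exact T.boundary_side s

theorem corners_subset_linkBoundary {v : X.Tet × Fin 4} (hv : X.VertexEqv v T.base) :
    T.corners ⊆ X.linkBoundary v := by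
  rintro ⟨t, i, k⟩ ⟨h1, h2⟩
  exact ⟨h1, (T.vertexEqv_of_mem_faces h2 h1).trans hv.symm, T.boundary_of_mem_faces h2⟩

theorem corners_nonempty : T.corners.Nonempty :=
  ⟨_, T.mem_corners_iff.2 ⟨false, 0, by decide, rfl⟩⟩

/-- The corners of the torus form one circle in the link of its vertex. -/
theorem corners_connected {v : X.Tet × Fin 4} (hv : X.VertexEqv v T.base) :
    ∀ c ∈ T.corners, ∀ d ∈ T.corners, Relation.EqvGen (X.LinkBoundaryAdj v) c d := by
  have adj : ∀ {s s' : Bool} {a b a' b' : Fin 4}, a ≠ 3 → b ≠ 3 → a ≠ b → a' ≠ 3 → b' ≠ 3 →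
      a' ≠ b' → X.EdgeEqv ((T.side s).edge a b) ((T.side s').edge a' b') →
      Relation.EqvGen (X.LinkBoundaryAdj v) ((T.side s).edge a 3) ((T.side s').edge a' 3) := by
    intro s s' a b a' b' ha hb hab ha' hb' hab' h
    refine .rel _ _ ⟨T.corners_subset_linkBoundary hv (T.mem_corners_iff.2 ⟨_, _, ha, rfl⟩),
      T.corners_subset_linkBoundary hv (T.mem_corners_iff.2 ⟨_, _, ha', rfl⟩),
      (T.side s).2 b, (T.side s').2 b', ?_, ?_, ?_, ?_, h⟩
    all_goals simpa [LFace.edge, eq_comm]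
  have q0 := adj (s := false) (s' := true) (a := 0) (b := 2) (a' := 0) (b' := 2)
    (by decide) (by decide) (by decide) (by decide) (by decide) (by decide) T.edge_z
  have q1 := adj (s := false) (s' := true) (a := 0) (b := 1) (a' := 1) (b' := 2)
    (by decide) (by decide) (by decide) (by decide) (by decide) (by decide) T.edge_x
  have p1 := adj (s := false) (s' := true) (a := 1) (b := 2) (a' := 0) (b' := 1)
    (by decide) (by decide) (by decide) (by decide) (by decide) (by decide) T.edge_y
  have p2 := adj (s := false) (s' := true) (a := 2) (b := 1) (a' := 1) (b' := 0)
    (by decide) (by decide) (by decide) (by decide) (by decide) (by decide) T.edge_y.reverse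
  have q2 := adj (s := false) (s' := true) (a := 2) (b := 0) (a' := 2) (b' := 0)
    (by decide) (by decide) (by decide) (by decide) (by decide) (by decide) T.edge_z.reverse
  have key : ∀ c ∈ T.corners,
      Relation.EqvGen (X.LinkBoundaryAdj v) c ((T.side false).edge 0 3) := by
    intro c hc
    obtain ⟨s, a, ha, rfl⟩ := T.mem_corners_iff.1 hc
    have p2' := p2.trans _ _ _ (q1.symm _ _)
    fin_cases a
    · cases s
      · exact .refl _
      · exact q0.symm
    · cases s
      · exact p1.trans _ _ _ (q0.symm _ _)
      · exact q1.symm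
    · cases s
      · exact p2'
      · exact (q2.symm _ _).trans _ _ _ p2'
    · exact absurd rfl ha
  exact fun c hc d hd => (key c hc).trans _ _ _ ((key d hd).symm _ _)

/-- A common endpoint of two boundary edges of the link is an edge of the triangulation at which two
boundary faces meet. If one of them belongs to the torus, so does the other, by `face_of_edgeEqv`.
-/
theorem corners_of_adj {v : X.Tet × Fin 4} {c d : X.Tet × Fin 4 × Fin 4}
    (h : X.LinkBoundaryAdj v c d) (hc : c ∈ T.corners) : d ∈ T.corners := by
  obtain ⟨s, a, ha, rfl⟩ := T.mem_corners_iff.1 hc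
  obtain ⟨t, i, k⟩ := d
  obtain ⟨-, ⟨hik, -, hk⟩, j, j', hj1, hj2, hj1', hj2', he⟩ := h
  dsimp only [LFace.edge] at hik hk hj1 hj2 hj1' hj2' he
  refine ⟨hik, ?_⟩
  dsimp only
  obtain ⟨π, h0, h1, h3⟩ := Fin.exists_perm_of_ne i j' k hj1'.symm hik hj2'
  obtain ⟨b, rfl⟩ := (T.side s).2.surjective j
  have key := T.face_of_edgeEqv (s := s) (a := a) (b := b) (m := (t, π)) ha
    (fun e => hj2 (by rw [e])) (fun e => hj1 (by rw [e])) (by rwa [LFace.face, h3])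
    (by dsimp only [LFace.edge]; rwa [h0, h1])
  rw [LFace.face, h3] at key
  rcases key with h | h
  · rw [h.1]
    exact T.side_mem_faces _
  · rw [h]
    exact T.side_mem_faces _

variable {T}

/-- The corners of the torus lie on the boundary of the link, so the link is not a sphere. -/
theorem linkIsDisc (hX : X.IsManifold) {v : X.Tet × Fin 4} (hv : X.VertexEqv v T.base) :
    X.LinkIsDisc v := by
  refine (hX.2 v).resolve_left fun h => ?_
  obtain ⟨c, hc⟩ := T.corners_nonempty
  have := T.corners_subset_linkBoundary hv hc
  rw [h.1] at this
  exact this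

/-- The boundary of the link of the vertex of the torus. -/
theorem linkBoundary_eq (hX : X.IsManifold) {v : X.Tet × Fin 4} (hv : X.VertexEqv v T.base) :
    X.linkBoundary v = T.corners := by
  refine Set.Subset.antisymm ?_ (T.corners_subset_linkBoundary hv)
  obtain ⟨c, hc⟩ := T.corners_nonempty
  intro d hd
  refine Relation.EqvGen.imp_of_step (r := X.LinkBoundaryAdj v) (P := (· ∈ T.corners)) ?_
    (fun _ _ => T.corners_of_adj)
    ((linkIsDisc hX hv).2.1 c (T.corners_subset_linkBoundary hv hc) d hd) hc
  rintro a b ⟨ha, hb, j, j', h1, h2, h3, h4, h5⟩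
  exact ⟨hb, ha, j', j, h3, h4, h1, h2, h5.symm⟩

/-- Different one-vertex tori in the boundary have different vertices. -/
theorem not_vertexEqv_base (hX : X.IsManifold) {T₀ T₁ : X.OneVertexTorus}
    (hT : Disjoint T₀.faces T₁.faces) : ¬ X.VertexEqv T₀.base T₁.base := by
  intro h
  obtain ⟨c, hc⟩ := T₁.corners_nonempty
  have h' := T₁.corners_subset_linkBoundary h hc
  rw [linkBoundary_eq (T := T₀) hX (.refl _)] at h'
  exact Set.disjoint_left.1 hT h'.2 hc.2

end OneVertexTorus

/-! ### Links of vertices -/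

/-- The pairs `(t, i, j)`, `i ≠ j`, with `(t, i)` identified with `v`: the edges of tetrahedra that
start at `v`, or the corners at `v` of their faces. -/
def star (X : Triangulation) (v : X.Tet × Fin 4) : Set (X.Tet × Fin 4 × Fin 4) :=
  {a | a.2.1 ≠ a.2.2 ∧ X.VertexEqv (a.1, a.2.1) v}

theorem linkEdges_eq (v : X.Tet × Fin 4) :
    X.linkEdges v = Quotient.mk X.cornerSetoid '' X.star v := by
  ext c
  constructor
  · rintro ⟨t, i, k, h, h', rfl⟩
    exact ⟨(t, i, k), ⟨h, h'⟩, rfl⟩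
  · rintro ⟨⟨t, i, k⟩, ⟨h, h'⟩, rfl⟩
    exact ⟨t, i, k, h, h', rfl⟩

theorem linkVertices_eq (v : X.Tet × Fin 4) :
    X.linkVertices v = Quotient.mk X.edgeSetoid '' X.star v := by
  ext c
  constructor
  · rintro ⟨t, i, k, h, h', rfl⟩
    exact ⟨(t, i, k), ⟨h, h'⟩, rfl⟩
  · rintro ⟨⟨t, i, k⟩, ⟨h, h'⟩, rfl⟩
    exact ⟨t, i, k, h, h', rfl⟩

theorem VertexEqv.link_congr {v w : X.Tet × Fin 4} (h : X.VertexEqv v w) :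
    (X.LinkIsSphere v ∨ X.LinkIsDisc v) ↔ (X.LinkIsSphere w ∨ X.LinkIsDisc w) := by
  have e : ∀ a, X.VertexEqv a v ↔ X.VertexEqv a w := fun a =>
    ⟨fun h' => h'.trans h, fun h' => h'.trans h.symm⟩
  have h1 : X.linkTriangles v = X.linkTriangles w := by ext a; exact e a
  have h2 : X.linkEdges v = X.linkEdges w := by simp only [linkEdges, e]
  have h3 : X.linkVertices v = X.linkVertices w := by simp only [linkVertices, e]
  have h4 : X.linkBoundary v = X.linkBoundary w := by simp only [linkBoundary, e]
  have h5 : X.LinkBoundaryAdj v = X.LinkBoundaryAdj w := by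
    ext c d
    simp only [LinkBoundaryAdj, h4]
  simp only [LinkIsSphere, LinkIsDisc, linkEuler, h1, h2, h3, h4, h5]

end Triangulation

/-! ### Counting classes -/

/-- Two maps that identify the same elements have images of the same size. -/
theorem Set.ncard_image_eq_ncard_image {α β γ : Type*} {s : Set α} {f : α → β} {g : α → γ}
    (h : ∀ a ∈ s, ∀ b ∈ s, f a = f b ↔ g a = g b) : (f '' s).ncard = (g '' s).ncard := by
  have h1 : Set.InjOn Prod.fst ((fun a => (f a, g a)) '' s) := by
    rintro _ ⟨a, ha, rfl⟩ _ ⟨b, hb, rfl⟩ e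
    exact Prod.ext e ((h a ha b hb).1 e)
  have h2 : Set.InjOn Prod.snd ((fun a => (f a, g a)) '' s) := by
    rintro _ ⟨a, ha, rfl⟩ _ ⟨b, hb, rfl⟩ e
    exact Prod.ext ((h a ha b hb).2 e) e
  have e1 := h1.ncard_image
  have e2 := h2.ncard_image
  rw [Set.image_image] at e1 e2
  exact e1.trans e2.symm

/-- The number of classes of a set to which a set of new singleton classes is added. -/
theorem Set.ncard_image_of_retract {α α' β β' : Type*} [Finite α'] {m : α → β} {m' : α' → β'}
    {f : α → α'} {s : Set α} {s' n : Set α'}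
    (h₁ : ∀ a ∈ s, ∀ b ∈ s, m' (f a) = m' (f b) ↔ m a = m b)
    (h₂ : ∀ a ∈ s, f a ∈ s') (h₃ : n ⊆ s')
    (h₄ : ∀ a ∈ s', a ∈ n ∨ ∃ b ∈ s, m' a = m' (f b))
    (h₅ : ∀ a ∈ n, ∀ b ∈ s', m' a = m' b → a = b)
    (h₆ : ∀ a ∈ s, f a ∉ n) :
    (m' '' s').ncard = (m '' s).ncard + n.ncard := by
  have e : m' '' s' = (fun a => m' (f a)) '' s ∪ m' '' n := by
    apply Set.Subset.antisymm
    · rintro _ ⟨a, ha, rfl⟩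
      rcases h₄ a ha with h | ⟨b, hb, h⟩
      · exact Or.inr ⟨a, h, rfl⟩
      · exact Or.inl ⟨b, hb, h.symm⟩
    · rintro _ (⟨a, ha, rfl⟩ | ⟨a, ha, rfl⟩)
      · exact ⟨_, h₂ a ha, rfl⟩
      · exact ⟨_, h₃ ha, rfl⟩
  have hd : Disjoint ((fun a => m' (f a)) '' s) (m' '' n) := by
    rw [Set.disjoint_left]
    rintro _ ⟨a, ha, rfl⟩ ⟨b, hb, h⟩
    exact h₆ a ha (h₅ b hb _ (h₂ a ha) h ▸ hb)
  have hfin : ((fun a => m' (f a)) '' s).Finite :=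
    (Set.toFinite (m' '' s')).subset (e ▸ Set.subset_union_left)
  rw [e, Set.ncard_union_eq hd hfin (Set.toFinite _), Set.ncard_image_eq_ncard_image h₁,
    Set.InjOn.ncard_image (fun a ha b hb h => h₅ a ha b (h₃ hb) h)]

namespace Triangulation

variable {X : Triangulation} (T : X.OneVertexTorus)

/-! ### Layering a tetrahedron on a torus -/

/-- The lower faces of the new tetrahedron. -/
def lowFace (s : Bool) : Fin 4 := bif s then 1 else 3

/-- The gluing of the lower faces of the new tetrahedron. -/
def lowPerm (s : Bool) : Perm (Fin 4) := (T.side s).2 * bif s then swap 1 3 else 1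

theorem lowPerm_lowFace (s : Bool) : lowPerm T s (lowFace s) = (T.side s).2 3 := by
  cases s <;> simp [lowPerm, lowFace]

/-- A simplex of an old tetrahedron. -/
def old {β : Type} (a : X.Tet × β) : (layer T).Tet × β := ((some a.1 : Option X.Tet), a.2)

/-- A simplex of the new tetrahedron. -/
def new {β : Type} (b : β) : (layer T).Tet × β := ((none : Option X.Tet), b)

theorem old_injective {β : Type} : Function.Injective (old T (β := β)) := by
  intro a b h
  have h' : ((some a.1 : Option X.Tet), a.2) = (some b.1, b.2) := h
  simpa [Prod.ext_iff] using h'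

theorem new_injective {β : Type} : Function.Injective (new T (β := β)) := fun _ _ h =>
  congrArg Prod.snd h

theorem old_ne_new {β : Type} (a : X.Tet × β) (b : β) : old T a ≠ new T b := fun h =>
  Option.some_ne_none a.1 (congrArg Prod.fst h)

theorem eq_old_or_new {β : Type} (c : (layer T).Tet × β) :
    (∃ a, c = old T a) ∨ ∃ b, c = new T b := by
  obtain ⟨_ | t, b⟩ := c
  · exact Or.inr ⟨b, rfl⟩
  · exact Or.inl ⟨(t, b), rfl⟩

theorem layer_glue_low (s : Bool) :
    (layer T).glue none (lowFace s) = some (some (T.side s).1, lowPerm T s) := by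
  cases s
  · change layerGlue T none 3 = some (some T.p.1, T.p.2 * 1)
    simp [layerGlue]
  · change layerGlue T none 1 = some (some T.q.1, T.q.2 * swap 1 3)
    simp [layerGlue]

theorem layer_glue_side (s : Bool) :
    (layer T).glue (some (T.side s).1) ((T.side s).2 3) = some (none, (lowPerm T s)⁻¹) := by
  rw [← lowPerm_lowFace]
  exact (layer T).glue_symm _ _ _ _ (layer_glue_low T s)

theorem layer_glue_none {k : Fin 4} {b : Option X.Tet × Perm (Fin 4)}
    (h : (layer T).glue none k = some b) :
    ∃ s, k = lowFace s ∧ b = (some (T.side s).1, lowPerm T s) := by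
  have key : ∃ s, k = lowFace s := by
    change layerGlue T none k = _ at h
    rw [layerGlue] at h
    split_ifs at h with h1 h2
    · exact ⟨false, h1⟩
    · exact ⟨true, h2⟩
  obtain ⟨s, rfl⟩ := key
  rw [layer_glue_low] at h
  exact ⟨s, rfl, (Option.some.inj h).symm⟩

theorem layer_glue_some_of_notMem {t : X.Tet} {k : Fin 4} (h : (t, k) ∉ T.faces) :
    (layer T).glue (some t) k = (X.glue t k).map fun b => (some b.1, b.2) := by
  have h1 : (t, k) ≠ T.p.face := fun e => h (Or.inl e)
  have h2 : (t, k) ≠ T.q.face := fun e => h (Or.inr e)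
  change layerGlue T (some t) k = _
  rw [layerGlue, if_neg h1, if_neg h2]

theorem layer_glue_cases {a b : Option X.Tet} {k : Fin 4} {σ : Perm (Fin 4)}
    (h : (layer T).glue a k = some (b, σ)) :
    (∃ s, a = none ∧ k = lowFace s ∧ b = some (T.side s).1 ∧ σ = lowPerm T s) ∨
    (∃ s, a = some (T.side s).1 ∧ k = (T.side s).2 3 ∧ b = none ∧ σ = (lowPerm T s)⁻¹) ∨
    (∃ t t', a = some t ∧ b = some t' ∧ X.glue t k = some (t', σ)) := by
  cases a with
  | none =>
    obtain ⟨s, rfl, hb⟩ := layer_glue_none T h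
    rw [Prod.mk.injEq] at hb
    exact Or.inl ⟨s, rfl, rfl, hb⟩
  | some t =>
    right
    by_cases hm : (t, k) ∈ T.faces
    · left
      obtain ⟨s, hs⟩ := T.mem_faces_iff.1 hm
      simp only [LFace.face, Prod.mk.injEq] at hs
      obtain ⟨rfl, rfl⟩ := hs
      have h' := Option.some.inj ((layer_glue_side T s).symm.trans h)
      exact ⟨s, rfl, rfl, (congrArg Prod.fst h').symm, (congrArg Prod.snd h').symm⟩
    · right
      obtain ⟨⟨t', τ⟩, hg, e⟩ :=
        Option.map_eq_some_iff.1 ((layer_glue_some_of_notMem T hm).symm.trans h)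
      rw [Prod.mk.injEq] at e
      obtain ⟨rfl, rfl⟩ := e
      exact ⟨t, t', rfl, rfl, hg⟩

theorem layer_isBoundary_new {k : Fin 4} : (layer T).IsBoundary (new T k) ↔ k = 0 ∨ k = 2 := by
  change layerGlue T none k = none ↔ _
  rw [layerGlue]
  fin_cases k <;> simp

theorem layer_isBoundary_old {f : X.Tet × Fin 4} :
    (layer T).IsBoundary (old T f) ↔ X.IsBoundary f ∧ f ∉ T.faces := by
  by_cases hm : f ∈ T.faces
  · obtain ⟨s, rfl⟩ := T.mem_faces_iff.1 hm
    simp only [hm, not_true_eq_false, and_false, iff_false]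
    intro h
    exact Option.some_ne_none _ ((layer_glue_side T s).symm.trans h)
  · simp only [hm, not_false_eq_true, and_true]
    refine (Eq.congr_left (layer_glue_some_of_notMem T hm)).trans ?_
    exact Option.map_eq_none_iff

theorem new_mem_layered_faces {k : Fin 4} : new T k ∈ T.layered.faces ↔ k = 0 ∨ k = 2 := by
  change new T k = new T ((swap 0 1 * swap 2 3 : Perm (Fin 4)) 3) ∨
    new T k = new T ((swap 0 1 * swap 1 2 * swap 2 3 : Perm (Fin 4)) 3) ↔ _
  rw [show (swap 0 1 * swap 2 3 : Perm (Fin 4)) 3 = 2 by decide,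
    show (swap 0 1 * swap 1 2 * swap 2 3 : Perm (Fin 4)) 3 = 0 by decide,
    (new_injective T).eq_iff, (new_injective T).eq_iff, or_comm]

/-! ### Edges and vertices after layering -/

theorem layer_edgeStep {a b : (layer T).Tet × Fin 4 × Fin 4} (h : (layer T).EdgeStep a b) :
    (∃ s i j, i ≠ lowFace s ∧ j ≠ lowFace s ∧ a = new T (i, j) ∧
      b = old T ((T.side s).1, lowPerm T s i, lowPerm T s j)) ∨
    (∃ s i j, i ≠ lowFace s ∧ j ≠ lowFace s ∧ b = new T (i, j) ∧
      a = old T ((T.side s).1, lowPerm T s i, lowPerm T s j)) ∨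
    (∃ a' b', X.EdgeStep a' b' ∧ a = old T a' ∧ b = old T b') := by
  obtain ⟨a, i, j⟩ := a
  obtain ⟨b, e⟩ := b
  obtain ⟨k, σ, hi, hj, hg, he⟩ := h
  dsimp only at hi hj hg he
  subst he
  rcases layer_glue_cases T hg with ⟨s, rfl, rfl, rfl, rfl⟩ | ⟨s, rfl, rfl, rfl, rfl⟩ |
    ⟨t, t', rfl, rfl, hg'⟩
  · exact Or.inl ⟨s, i, j, hi.symm, hj.symm, rfl, rfl⟩
  · refine Or.inr (Or.inl ⟨s, _, _, ?_, ?_, rfl, by simp [old]⟩)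
    · rw [← lowPerm_lowFace] at hi
      rintro e
      exact hi (by rw [← e]; simp)
    · rw [← lowPerm_lowFace] at hj
      rintro e
      exact hj (by rw [← e]; simp)
  · exact Or.inr (Or.inr ⟨(t, i, j), (t', σ i, σ j), ⟨k, σ, hi, hj, hg', rfl⟩, rfl, rfl⟩)

/-- An edge of the old triangulation that is identified with a given edge, unless this is the new
edge. -/
def layerEdge : Option X.Tet × Fin 4 × Fin 4 → X.Tet × Fin 4 × Fin 4
  | (some t, e) => (t, e)
  | (none, i, j) =>
    if i ≠ 3 ∧ j ≠ 3 then T.p.edge i j else T.q.edge (swap 1 3 i) (swap 1 3 j)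

theorem layerEdge_new (i j : Fin 4) : layerEdge T (new T (i, j)) =
    if i ≠ 3 ∧ j ≠ 3 then T.p.edge i j else T.q.edge (swap 1 3 i) (swap 1 3 j) := rfl

/-- The two lower faces share the edge AC, where `layerEdge` uses `p`; the value on `q` is
equivalent by `edge_z`. Degenerate edges are covered too, because vertices are later treated as
such. -/
theorem layerEdge_low {s : Bool} {i j : Fin 4} (hi : i ≠ lowFace s) (hj : j ≠ lowFace s) :
    X.EdgeEqv (layerEdge T (new T (i, j))) ((T.side s).1, lowPerm T s i, lowPerm T s j) := by
  rw [layerEdge_new]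
  cases s
  · change i ≠ 3 at hi
    change j ≠ 3 at hj
    rw [if_pos ⟨hi, hj⟩]
    exact .refl _
  · change i ≠ 1 at hi
    change j ≠ 1 at hj
    split_ifs with h
    · obtain ⟨hi', hj'⟩ := h
      change X.EdgeEqv _ (T.q.1, T.q.2 (swap 1 3 i), T.q.2 (swap 1 3 j))
      rw [swap_apply_of_ne_of_ne hi hi', swap_apply_of_ne_of_ne hj hj']
      by_cases hij : i = j
      · subst hij
        exact (T.vertexEqv_edge false true hi' hi').edgeEqv
      · fin_cases i <;> fin_cases j <;> first
          | exact absurd rfl hi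
          | exact absurd rfl hj
          | exact absurd rfl hi'
          | exact absurd rfl hj'
          | exact absurd rfl hij
          | exact T.edge_z
          | exact T.edge_z.reverse
    · exact .refl _

/-- `layerEdge` descends to classes of edges and is the identity on old edges; hence layering
identifies no old edges that were distinct before. Its arbitrary value on the new edge does no harm,
since no step touches that edge. -/
theorem layerEdge_edgeEqv {a b : (layer T).Tet × Fin 4 × Fin 4} (h : (layer T).EdgeEqv a b) :
    X.EdgeEqv (layerEdge T a) (layerEdge T b) := by
  have key : ∀ a b, Relation.EqvGen (layer T).EdgeStep a b →
      X.EdgeEqv (layerEdge T a) (layerEdge T b) := by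
    intro a b hab
    induction hab with
    | rel a b h =>
      rcases layer_edgeStep T h with ⟨s, i, j, hi, hj, rfl, rfl⟩ | ⟨s, i, j, hi, hj, rfl, rfl⟩ |
        ⟨a, b, h', rfl, rfl⟩
      · exact layerEdge_low T hi hj
      · exact (layerEdge_low T hi hj).symm
      · exact .rel _ _ h'
    | refl a => exact .refl _
    | symm a b _ ih => exact ih.symm
    | trans a b c _ _ ih1 ih2 => exact ih1.trans ih2
  exact key _ _ h

/-- The new edge and its reverse. -/
def newEdges : Set ((layer T).Tet × Fin 4 × Fin 4) := new T '' {(1, 3), (3, 1)}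

/-- The edge BE lies in neither of the lower faces, which are the only glued faces of the new
tetrahedron. -/
theorem eq_of_mem_newEdges {a b : (layer T).Tet × Fin 4 × Fin 4} (h : (layer T).EdgeEqv a b)
    (ha : a ∈ newEdges T) : a = b := by
  obtain ⟨x, hx, rfl⟩ := ha
  refine Relation.EqvGen.imp_of_step (r := (layer T).EdgeStep) (P := fun c => new T x = c)
    (fun _ _ => EdgeStep.symm) ?_ h rfl
  rintro _ c hc rfl
  exfalso
  rcases layer_edgeStep T hc with ⟨s, i, j, hi, hj, h, -⟩ | ⟨s, i, j, -, -, -, h⟩ |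
    ⟨a', b', -, h, -⟩
  · rw [new_injective T h] at hx
    cases s <;> simp_all [lowFace]
  · exact old_ne_new T _ _ h.symm
  · exact old_ne_new T _ _ h.symm

theorem edgeEqv_layerEdge {a : (layer T).Tet × Fin 4 × Fin 4} (ha : a ∉ newEdges T) :
    (layer T).EdgeEqv a (old T (layerEdge T a)) := by
  rcases eq_old_or_new T a with ⟨a, rfl⟩ | ⟨⟨i, j⟩, rfl⟩
  · exact .refl _
  · have hx : (i, j) ∉ ({(1, 3), (3, 1)} : Set (Fin 4 × Fin 4)) := fun h => ha ⟨_, h, rfl⟩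
    rw [layerEdge_new]
    by_cases hij : i = j
    · subst hij
      split_ifs with h
      · exact layer_edge_p T i i h.1 h.2
      · have : i ≠ 1 := by
          rintro rfl
          exact h (by decide)
        exact layer_edge_q T i i this this
    · split_ifs with h
      · exact layer_edge_p T i j h.1 h.2
      · have : i ≠ 1 ∧ j ≠ 1 := by
          clear ha
          revert hx hij h
          revert i j
          decide
        exact layer_edge_q T i j this.1 this.2

theorem EdgeEqv.old {a b : X.Tet × Fin 4 × Fin 4} (h : X.EdgeEqv a b) :
    (layer T).EdgeEqv (old T a) (old T b) :=
  h.map (Y := layer T) some (layer_glue_some T)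

theorem layer_edgeEqv_old {a b : X.Tet × Fin 4 × Fin 4} :
    (layer T).EdgeEqv (old T a) (old T b) ↔ X.EdgeEqv a b :=
  ⟨layerEdge_edgeEqv T, EdgeEqv.old T⟩

/-- The vertex of the old triangulation that is identified with a given vertex. -/
def layerVertex : Option X.Tet × Fin 4 → X.Tet × Fin 4
  | (some t, i) => (t, i)
  | (none, _) => T.base

theorem VertexEqv.old {a b : X.Tet × Fin 4} (h : X.VertexEqv a b) :
    (layer T).VertexEqv (old T a) (old T b) :=
  (h.edgeEqv.old T).vertexEqv

theorem vertexEqv_layerVertex (a : (layer T).Tet × Fin 4) :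
    (layer T).VertexEqv a (old T (layerVertex T a)) := by
  rcases eq_old_or_new T a with ⟨a, rfl⟩ | ⟨i, rfl⟩
  · exact .refl _
  · have key : ∃ s, i ≠ lowFace s := by
      by_cases h : i = 3
      · exact ⟨true, by rw [h]; decide⟩
      · exact ⟨false, h⟩
    obtain ⟨s, hs⟩ := key
    have h1 : (layer T).VertexEqv (new T i) (Triangulation.old T ((T.side s).1, lowPerm T s i)) :=
      .rel _ _ ⟨lowFace s, lowPerm T s, hs.symm, layer_glue_low T s, rfl⟩
    have h2 : X.VertexEqv ((T.side s).1, lowPerm T s i) T.base := by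
      refine T.vertexEqv_of_mem_faces (k := (T.side s).2 3) (T.side_mem_faces s) ?_
      rw [← lowPerm_lowFace]
      exact fun e => hs ((lowPerm T s).injective e)
    exact h1.trans (h2.old T)

/-- Vertices are viewed as degenerate edges, so that the retraction `layerEdge` applies to them. All
four new vertices fall into the class of the vertex of the torus. -/
theorem layer_vertexEqv {a b : (layer T).Tet × Fin 4} :
    (layer T).VertexEqv a b ↔ X.VertexEqv (layerVertex T a) (layerVertex T b) := by
  have h1 : ∀ (t : Option X.Tet) i, X.VertexEqv (layerVertex T (t, i))
      ((layerEdge T (t, i, i)).1, (layerEdge T (t, i, i)).2.1) := by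
    rintro (_ | t) i
    · rw [layerEdge]
      split_ifs with h
      · exact (T.vertexEqv_base false h.1).symm
      · obtain rfl : i = 3 := by tauto
        exact (T.vertexEqv_base true (a := 1) (by decide)).symm
    · exact .refl _
  constructor
  · intro h
    exact ((h1 _ _).trans (layerEdge_edgeEqv T h.edgeEqv).vertexEqv).trans (h1 _ _).symm
  · intro h
    exact (vertexEqv_layerVertex T a).trans ((h.old T).trans (vertexEqv_layerVertex T b).symm)

theorem layer_cornerSetoid_old {a b : X.Tet × Fin 4 × Fin 4} :
    (layer T).cornerSetoid (old T a) (old T b) ↔ X.cornerSetoid a b := by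
  rw [cornerSetoid_iff, cornerSetoid_iff, (old_injective T).eq_iff]
  refine or_congr Iff.rfl ⟨?_, ?_⟩
  · rintro ⟨σ, hg, he⟩
    rcases layer_glue_cases T hg with ⟨s, h, -⟩ | ⟨s, -, -, h, -⟩ | ⟨t, t', h, h', hg'⟩
    · exact absurd h (Option.some_ne_none _)
    · exact absurd h (Option.some_ne_none _)
    · cases Option.some.inj h
      cases Option.some.inj h'
      exact ⟨σ, hg', he⟩
  · rintro ⟨σ, hg, he⟩
    exact ⟨σ, layer_glue_some T _ _ _ _ hg, he⟩

/-! ### Links after layering -/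

/-- The corners of the upper faces of the new tetrahedron. -/
def newCorners : Set ((layer T).Tet × Fin 4 × Fin 4) :=
  new T '' {x | x.1 ≠ x.2 ∧ (x.2 = 0 ∨ x.2 = 2)}

theorem ncard_newCorners : (newCorners T).ncard = 6 := by
  rw [newCorners, Set.ncard_image_of_injective _ (new_injective T),
    Set.ncard_eq_toFinset_card']
  rfl

theorem ncard_newEdges : (newEdges T).ncard = 2 := by
  rw [newEdges, Set.ncard_image_of_injective _ (new_injective T), Set.ncard_pair (by simp)]

theorem eq_of_mem_newCorners {a b : (layer T).Tet × Fin 4 × Fin 4}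
    (h : (layer T).cornerSetoid a b) (ha : a ∈ newCorners T) : a = b := by
  rcases cornerSetoid_iff.1 h with h | ⟨σ, hg, he⟩
  · exact h
  · obtain ⟨⟨i, k⟩, ⟨-, hk⟩, rfl⟩ := ha
    obtain ⟨s, h, -⟩ := layer_glue_none T hg
    change k = lowFace s at h
    subst h
    cases s <;> rcases hk with hk | hk <;> simp [lowFace] at hk

theorem cornerSetoid_low (s : Bool) (i : Fin 4) :
    (layer T).cornerSetoid (new T (i, lowFace s))
      (old T ((T.side s).1, lowPerm T s i, (T.side s).2 3)) :=
  cornerSetoid_iff.2 (Or.inr ⟨lowPerm T s, layer_glue_low T s, by rw [← lowPerm_lowFace]; rfl⟩)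

theorem old_mem_layer_star {v : X.Tet × Fin 4} {a : X.Tet × Fin 4 × Fin 4} :
    old T a ∈ (layer T).star (old T v) ↔ a ∈ X.star v :=
  and_congr Iff.rfl (layer_vertexEqv T)

theorem new_mem_layer_star {v : X.Tet × Fin 4} {x : Fin 4 × Fin 4} :
    new T x ∈ (layer T).star (old T v) ↔ x.1 ≠ x.2 ∧ X.VertexEqv T.base v :=
  and_congr Iff.rfl (layer_vertexEqv T)

theorem mk_layer_edge_iff {a b : X.Tet × Fin 4 × Fin 4} :
    Quotient.mk (layer T).edgeSetoid (old T a) = Quotient.mk (layer T).edgeSetoid (old T b) ↔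
      Quotient.mk X.edgeSetoid a = Quotient.mk X.edgeSetoid b :=
  Quotient.eq.trans ((layer_edgeEqv_old T).trans Quotient.eq.symm)

theorem mk_layer_corner_iff {a b : X.Tet × Fin 4 × Fin 4} :
    Quotient.mk (layer T).cornerSetoid (old T a) = Quotient.mk (layer T).cornerSetoid (old T b) ↔
      Quotient.mk X.cornerSetoid a = Quotient.mk X.cornerSetoid b :=
  Quotient.eq.trans ((layer_cornerSetoid_old T).trans Quotient.eq.symm)

theorem linkEuler_layer_of_not {v : X.Tet × Fin 4} (hv : ¬ X.VertexEqv T.base v) :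
    (layer T).linkEuler (old T v) = X.linkEuler v := by
  have hs : (layer T).star (old T v) = old T '' X.star v := by
    ext a
    rcases eq_old_or_new T a with ⟨a, rfl⟩ | ⟨x, rfl⟩
    · rw [old_mem_layer_star, (old_injective T).mem_set_image]
    · rw [new_mem_layer_star]
      exact ⟨fun h => absurd h.2 hv, fun ⟨b, _, h⟩ => absurd h (old_ne_new T _ _)⟩
  have ht : (layer T).linkTriangles (old T v) = old T '' X.linkTriangles v := by
    ext a
    rcases eq_old_or_new T a with ⟨a, rfl⟩ | ⟨x, rfl⟩
    · rw [(old_injective T).mem_set_image]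
      exact layer_vertexEqv T
    · exact ⟨fun h => absurd ((layer_vertexEqv T).1 h) hv,
        fun ⟨b, _, h⟩ => absurd h (old_ne_new T _ _)⟩
  rw [linkEuler, linkEuler, linkEdges_eq, linkEdges_eq, linkVertices_eq, linkVertices_eq, hs, ht,
    Set.image_image, Set.image_image,
    Set.ncard_image_eq_ncard_image fun a _ b _ => mk_layer_edge_iff T (a := a) (b := b),
    Set.ncard_image_eq_ncard_image fun a _ b _ => mk_layer_corner_iff T (a := a) (b := b),
    Set.ncard_image_of_injective _ (old_injective T)]

theorem linkEuler_layer {v : X.Tet × Fin 4} (hv : X.VertexEqv T.base v) :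
    (layer T).linkEuler (old T v) = X.linkEuler v := by
  have := X.finite
  have := (layer T).finite
  -- The two new vertices are the two ends of the new edge.
  have hE : ((layer T).linkVertices (old T v)).ncard = (X.linkVertices v).ncard + 2 := by
    rw [linkVertices_eq, linkVertices_eq, ← ncard_newEdges T]
    refine Set.ncard_image_of_retract (f := old T) (fun a _ b _ => mk_layer_edge_iff T)
      (fun a => (old_mem_layer_star T).2) ?_ ?_
      (fun a ha b _ h => eq_of_mem_newEdges T (Quotient.exact h) ha) ?_
    · rintro _ ⟨x, rfl | rfl, rfl⟩
      · exact (new_mem_layer_star T).2 ⟨by decide, hv⟩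
      · exact (new_mem_layer_star T).2 ⟨by decide, hv⟩
    · intro a ha
      rw [or_iff_not_imp_left]
      intro hn
      have h := edgeEqv_layerEdge T hn
      refine ⟨layerEdge T a, (old_mem_layer_star T).1 ⟨?_, ?_⟩, Quotient.sound h⟩
      · rcases eq_old_or_new T a with ⟨a, rfl⟩ | ⟨⟨i, j⟩, rfl⟩
        · exact ha.1
        · have h1 : i ≠ j := ha.1
          change (layerEdge T (new T (i, j))).2.1 ≠ (layerEdge T (new T (i, j))).2.2
          rw [layerEdge_new]
          split_ifs <;> simpa [LFace.edge] using h1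
      · exact h.vertexEqv.symm.trans ha.2
    · rintro a - ⟨x, -, h⟩
      exact old_ne_new T _ _ h.symm
  -- The six new edges are the three corners of each of the two upper faces; the corners of the
  -- lower faces are identified with old ones.
  have hC : ((layer T).linkEdges (old T v)).ncard = (X.linkEdges v).ncard + 6 := by
    rw [linkEdges_eq, linkEdges_eq, ← ncard_newCorners T]
    refine Set.ncard_image_of_retract (f := old T) (fun a _ b _ => mk_layer_corner_iff T)
      (fun a => (old_mem_layer_star T).2) ?_ ?_
      (fun a ha b _ h => eq_of_mem_newCorners T (Quotient.exact h) ha) ?_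
    · rintro _ ⟨⟨i, k⟩, ⟨h, -⟩, rfl⟩
      exact (new_mem_layer_star T).2 ⟨h, hv⟩
    · intro a ha
      rcases eq_old_or_new T a with ⟨a, rfl⟩ | ⟨⟨i, k⟩, rfl⟩
      · exact Or.inr ⟨a, (old_mem_layer_star T).1 ha, rfl⟩
      · have hik : i ≠ k := ha.1
        have hk : (k = 0 ∨ k = 2) ∨ ∃ s, k = lowFace s := by
          fin_cases k
          · simp
          · exact Or.inr ⟨true, rfl⟩
          · simp
          · exact Or.inr ⟨false, rfl⟩
        rcases hk with hk | ⟨s, rfl⟩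
        · exact Or.inl ⟨(i, k), ⟨hik, hk⟩, rfl⟩
        · right
          have hne : lowPerm T s i ≠ (T.side s).2 3 := by
            rw [← lowPerm_lowFace]
            exact fun e => hik ((lowPerm T s).injective e)
          exact ⟨((T.side s).1, lowPerm T s i, (T.side s).2 3), ⟨hne,
            (T.vertexEqv_of_mem_faces (T.side_mem_faces s) hne).trans hv⟩,
            Quotient.sound (cornerSetoid_low T s i)⟩
    · rintro a - ⟨x, -, h⟩
      exact old_ne_new T _ _ h.symm
  -- The four new triangles are the four vertices of the new tetrahedron.
  have hF : ((layer T).linkTriangles (old T v)).ncard = (X.linkTriangles v).ncard + 4 := by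
    have h1 : (layer T).linkTriangles (old T v) =
        old T '' X.linkTriangles v ∪ new T '' Set.univ := by
      ext a
      rcases eq_old_or_new T a with ⟨a, rfl⟩ | ⟨x, rfl⟩
      · rw [Set.mem_union, (old_injective T).mem_set_image]
        refine (layer_vertexEqv T).trans ⟨Or.inl, ?_⟩
        rintro (h | ⟨b, -, h⟩)
        · exact h
        · exact absurd h.symm (old_ne_new T _ _)
      · exact ⟨fun _ => Or.inr ⟨x, trivial, rfl⟩, fun _ => (layer_vertexEqv T).2 hv⟩
    have h2 : Disjoint (old T '' X.linkTriangles v) (new T '' Set.univ) := by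
      rw [Set.disjoint_left]
      rintro _ ⟨a, -, rfl⟩ ⟨b, -, h⟩
      exact old_ne_new T _ _ h.symm
    rw [h1, Set.ncard_union_eq h2 (Set.toFinite _) (Set.toFinite _),
      Set.ncard_image_of_injective _ (old_injective T),
      Set.ncard_image_of_injective _ (new_injective T),
      Set.ncard_univ, Nat.card_eq_fintype_card, Fintype.card_fin]
  rw [linkEuler, linkEuler, hE, hC, hF]
  push_cast
  ring

variable {T}

theorem LinkBoundaryAdj.map {Y : Triangulation} (f : X.Tet → Y.Tet)
    (hf : ∀ t k t' σ, X.glue t k = some (t', σ) → Y.glue (f t) k = some (f t', σ))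
    {v : X.Tet × Fin 4} {w : Y.Tet × Fin 4}
    (hB : ∀ c ∈ X.linkBoundary v, (f c.1, c.2) ∈ Y.linkBoundary w)
    {c d : X.Tet × Fin 4 × Fin 4} (h : Relation.EqvGen (X.LinkBoundaryAdj v) c d) :
    Relation.EqvGen (Y.LinkBoundaryAdj w) (f c.1, c.2) (f d.1, d.2) := by
  induction h with
  | rel c d h =>
    obtain ⟨hc, hd, j, j', h1, h2, h3, h4, h5⟩ := h
    exact .rel _ _ ⟨hB c hc, hB d hd, j, j', h1, h2, h3, h4, h5.map f hf⟩
  | refl a => exact .refl _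
  | symm a b _ ih => exact .symm _ _ ih
  | trans a b c _ _ ih1 ih2 => exact .trans _ _ _ ih1 ih2

/-- Layering a tetrahedron on a one-vertex torus in the boundary gives a manifold again. -/
theorem layer_isManifold (hX : X.IsManifold) : (layer T).IsManifold := by
  constructor
  · intro t i j hij h
    by_cases hn : (t, i, j) ∈ newEdges T
    · exact hij (congrArg (fun a => a.2.1) (eq_of_mem_newEdges T h hn))
    · have h' := layerEdge_edgeEqv T h
      obtain _ | t := t
      · simp only [layerEdge, and_comm (a := j ≠ 3)] at h'
        split_ifs at h' with hc
        · exact hX.1 _ _ _ (T.p.2.injective.ne hij) h'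
        · exact hX.1 _ _ _ (T.q.2.injective.ne ((swap 1 3).injective.ne hij)) h'
      · exact hX.1 _ _ _ hij h'
  · intro w
    rw [(vertexEqv_layerVertex T w).link_congr]
    generalize layerVertex T w = v
    by_cases hv : X.VertexEqv T.base v
    · right
      have hb : (layer T).VertexEqv (old T v) T.layered.base := (layer_vertexEqv T).2 hv.symm
      -- The old boundary of this link consisted of the corners of `T`, all of which are now
      -- covered; only corners of the upper faces remain.
      have hB : (layer T).linkBoundary (old T v) = T.layered.corners := by
        refine Set.Subset.antisymm ?_ (T.layered.corners_subset_linkBoundary hb)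
        intro a ha
        rcases eq_old_or_new T a with ⟨⟨t, i, k⟩, rfl⟩ | ⟨⟨i, k⟩, rfl⟩
        · obtain ⟨h1, h2, h3⟩ := ha
          obtain ⟨h3, h4⟩ := (layer_isBoundary_old T (f := (t, k))).1 h3
          have h5 : (t, i, k) ∈ X.linkBoundary v := ⟨h1, (layer_vertexEqv T).1 h2, h3⟩
          rw [OneVertexTorus.linkBoundary_eq hX hv.symm] at h5
          exact absurd h5.2 h4
        · exact ⟨ha.1, (new_mem_layered_faces T).2 ((layer_isBoundary_new T).1 ha.2.2)⟩
      refine ⟨?_, ?_, ?_⟩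
      · rw [hB]
        exact T.layered.corners_nonempty
      · rw [hB]
        exact T.layered.corners_connected hb
      · rw [linkEuler_layer T hv]
        exact (OneVertexTorus.linkIsDisc hX hv.symm).2.2
    · have hB : (layer T).linkBoundary (old T v) = old T '' X.linkBoundary v := by
        ext a
        rcases eq_old_or_new T a with ⟨⟨t, i, k⟩, rfl⟩ | ⟨x, rfl⟩
        · rw [(old_injective T).mem_set_image]
          constructor
          · rintro ⟨h1, h2, h3⟩
            exact ⟨h1, (layer_vertexEqv T).1 h2, ((layer_isBoundary_old T (f := (t, k))).1 h3).1⟩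
          · rintro ⟨h1, h2, h3⟩
            exact ⟨h1, (layer_vertexEqv T).2 h2, (layer_isBoundary_old T (f := (t, k))).2
              ⟨h3, fun h4 => hv ((T.vertexEqv_of_mem_faces h4 h1).symm.trans h2)⟩⟩
        · exact ⟨fun h => absurd ((layer_vertexEqv T).1 h.2.1) hv,
            fun ⟨b, _, h⟩ => absurd h (old_ne_new T _ _)⟩
      refine (hX.2 v).imp (fun h => ⟨?_, ?_⟩) (fun h => ⟨?_, ?_, ?_⟩)
      · rw [hB, h.1, Set.image_empty]
      · rw [linkEuler_layer_of_not T hv, h.2]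
      · rw [hB]
        exact h.1.image _
      · rw [hB]
        rintro _ ⟨c, hc, rfl⟩ _ ⟨d, hd, rfl⟩
        refine LinkBoundaryAdj.map (Y := layer T) some (layer_glue_some T) (fun c hc => ?_)
          (h.2.1 c hc d hd)
        rw [hB]
        exact ⟨c, hc, rfl⟩
      · rw [linkEuler_layer_of_not T hv, h.2.2]

theorem layer_isOrientable (hX : X.IsOrientable) : (layer T).IsOrientable := by
  obtain ⟨o, ho⟩ := hX
  -- The transposition in the gluing of `q` compensates for the opposite signs of `p` and `q`, so
  -- both lower faces impose the same orientation on the new tetrahedron.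
  have hs : ∀ s, Perm.sign (lowPerm T s) * o (T.side s).1 = T.p.sgn o := by
    rintro (_ | _)
    · change Perm.sign (T.p.2 * 1) * o T.p.1 = _
      rw [mul_one, LFace.sgn]
    · change Perm.sign (T.q.2 * swap 1 3) * o T.q.1 = _
      rw [Perm.sign_mul, Perm.sign_swap (show (1 : Fin 4) ≠ 3 by decide), mul_neg_one, neg_mul,
        ← LFace.sgn, T.sgn_side ho, neg_neg]
  refine ⟨fun t => Option.elim t (- T.p.sgn o) o, fun t k t' σ h => ?_⟩
  rcases layer_glue_cases T h with ⟨s, rfl, rfl, rfl, rfl⟩ | ⟨s, rfl, rfl, rfl, rfl⟩ |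
    ⟨t, t', rfl, rfl, hg⟩
  · change o (T.side s).1 = - (Perm.sign (lowPerm T s) * - T.p.sgn o)
    rw [← hs s, mul_neg, neg_neg, ← mul_assoc, Int.units_mul_self, one_mul]
  · change - T.p.sgn o = - (Perm.sign (lowPerm T s)⁻¹ * o (T.side s).1)
    rw [Perm.sign_inv, hs]
  · exact ho _ _ _ _ hg

end Triangulation

/-- The number of classes of the union of two sets of which some classes are identified. -/
theorem Set.ncard_image_union_add {α β β' : Type*} [Finite α] {m : α → β} {m' : α → β'}
    {s₀ s₁ c : Set α}
    (h₀ : ∀ a ∈ s₀, ∀ b ∈ s₀, m' a = m' b ↔ m a = m b)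
    (h₁ : ∀ a ∈ s₁, ∀ b ∈ s₁, m' a = m' b ↔ m a = m b)
    (hc : c ⊆ s₀) (hm : Set.InjOn m c)
    (h : ∀ a ∈ s₀, ∀ b ∈ s₁, m' a = m' b → ∃ x ∈ c, m' a = m' x)
    (h' : ∀ x ∈ c, ∃ b ∈ s₁, m' x = m' b) :
    (m' '' (s₀ ∪ s₁)).ncard + c.ncard = (m '' s₀).ncard + (m '' s₁).ncard := by
  have e : m' '' s₀ ∩ m' '' s₁ = m' '' c := by
    apply Set.Subset.antisymm
    · rintro _ ⟨⟨a, ha, rfl⟩, b, hb, hab⟩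
      obtain ⟨x, hx, hax⟩ := h a ha b hb hab.symm
      exact ⟨x, hx, hax.symm⟩
    · rintro _ ⟨x, hx, rfl⟩
      obtain ⟨b, hb, hxb⟩ := h' x hx
      exact ⟨⟨x, hc hx, rfl⟩, b, hb, hxb.symm⟩
  have hi : Set.InjOn m' c := fun a ha b hb hab =>
    hm ha hb ((h₀ a (hc ha) b (hc hb)).1 hab)
  rw [← hi.ncard_image, ← e, Set.image_union,
    Set.ncard_union_add_ncard_inter _ _ (Set.toFinite _) (Set.toFinite _),
    Set.ncard_image_eq_ncard_image h₀, Set.ncard_image_eq_ncard_image h₁]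

namespace Triangulation

variable {X : Triangulation}

/-! ### Comparing the edges of two tori -/

theorem EdgeEqv.eq_iff_eq {a b : X.Tet × Fin 4 × Fin 4} (h : X.EdgeEqv a b) :
    a.2.1 = a.2.2 ↔ b.2.1 = b.2.2 := by
  have key : ∀ a b, Relation.EqvGen X.EdgeStep a b → (a.2.1 = a.2.2 ↔ b.2.1 = b.2.2) := by
    intro a b hab
    induction hab with
    | rel a b h =>
      obtain ⟨k, σ, h1, h2, h3, h4⟩ := h
      simp [h4]
    | refl a => exact Iff.rfl
    | symm a b _ ih => exact ih.symm
    | trans a b c _ _ ih1 ih2 => exact ih1.trans ih2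
  exact key _ _ h

/-- Edges of different one-vertex tori are identified with each other in the same way. -/
theorem OneVertexTorus.edgeEqv_transfer (T T' : X.OneVertexTorus) {s s' : Bool}
    {i j i' j' : Fin 4} (hi : i ≠ 3) (hj : j ≠ 3) (hi' : i' ≠ 3) (hj' : j' ≠ 3)
    (h : X.EdgeEqv ((T.side s).edge i j) ((T.side s').edge i' j')) :
    X.EdgeEqv ((T'.side s).edge i j) ((T'.side s').edge i' j') := by
  have hd : i = j ↔ i' = j' := by simpa [LFace.edge] using h.eq_iff_eq
  by_cases hij : i = j
  · obtain rfl := hij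
    obtain rfl := hd.1 rfl
    exact (T'.vertexEqv_edge s s' hi hi').edgeEqv
  · have hij' : i' ≠ j' := fun e => hij (hd.2 e)
    -- By `edge_injective` the only identifications are the trivial one within a face and `mate`
    -- across the two faces, and neither depends on the torus.
    by_cases hs : s' = s
    · subst hs
      obtain ⟨rfl, rfl⟩ := T.edge_injective hi hj hij hi' hj' hij' h
      exact .refl _
    · obtain rfl : s' = !s := by cases s <;> cases s' <;> simp_all
      obtain ⟨h1, h2, h3⟩ := mate_ne hi hj hij
      obtain ⟨rfl, rfl⟩ := T.edge_injective h1 h2 h3 hi' hj' hij'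
        ((T.edgeEqv_mate s hi hj hij).symm.trans h)
      exact T'.edgeEqv_mate s hi hj hij

theorem OneVertexTorus.ncard_corners (T : X.OneVertexTorus) : T.corners.ncard = 6 := by
  have e : T.corners = (fun x : Bool × Fin 4 => (T.side x.1).edge x.2 3) '' {x | x.2 ≠ 3} := by
    ext c
    rw [T.mem_corners_iff]
    constructor
    · rintro ⟨s, a, ha, rfl⟩
      exact ⟨(s, a), ha, rfl⟩
    · rintro ⟨⟨s, a⟩, ha, rfl⟩
      exact ⟨s, a, ha, rfl⟩
  rw [e, Set.ncard_image_of_injective, Set.ncard_eq_toFinset_card']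
  · rfl
  · rintro ⟨s, a⟩ ⟨s', a'⟩ h
    simp only [LFace.edge, Prod.mk.injEq] at h
    obtain rfl : s = s' := T.side_face_injective (Prod.ext h.1 h.2.2)
    rw [(T.side s).2.injective h.2.1]

/-- The edges of the first face of the torus. -/
def OneVertexTorus.edges (T : X.OneVertexTorus) : Set (X.Tet × Fin 4 × Fin 4) :=
  (fun x : Fin 4 × Fin 4 => (T.side false).edge x.1 x.2) '' {x | x.1 ≠ 3 ∧ x.2 ≠ 3 ∧ x.1 ≠ x.2}

theorem OneVertexTorus.ncard_edges (T : X.OneVertexTorus) : T.edges.ncard = 6 := by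
  rw [edges, Set.ncard_image_of_injective, Set.ncard_eq_toFinset_card']
  · rfl
  · rintro ⟨i, j⟩ ⟨i', j'⟩ h
    simpa [LFace.edge] using h

/-! ### Gluing two tori -/

variable {T₀ T₁ : X.OneVertexTorus} (h : Disjoint T₀.faces T₁.faces)

/-- A simplex of a tetrahedron, after gluing. -/
def emb {β : Type} (a : X.Tet × β) : (glueTori T₀ T₁ h).Tet × β := ((a.1 : X.Tet), a.2)

theorem emb_injective {β : Type} : Function.Injective (emb h (β := β)) := fun _ _ e => e

theorem emb_surjective {β : Type} : Function.Surjective (emb h (β := β)) := fun a => ⟨a, rfl⟩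

theorem glueTori_of_glue {t t' : X.Tet} {k : Fin 4} {σ : Perm (Fin 4)}
    (e : X.glue t k = some (t', σ)) : (glueTori T₀ T₁ h).glue t k = some (t', σ) := by
  have hb : ∀ f : X.Tet × Fin 4, X.IsBoundary f → (t, k) ≠ f := by
    rintro f hf rfl
    rw [IsBoundary, e] at hf
    exact absurd hf (by simp)
  change torusGlue T₀ T₁ t k = _
  rw [torusGlue, if_neg (hb _ T₀.boundary_p), if_neg (hb _ T₀.boundary_q),
    if_neg (hb _ T₁.boundary_p), if_neg (hb _ T₁.boundary_q), e]

theorem glueTori_side (s : Bool) :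
    (glueTori T₀ T₁ h).glue (T₀.side s).1 ((T₀.side s).2 3) =
      some ((T₁.side s).1, (T₁.side s).2 * (T₀.side s).2⁻¹) := by
  obtain ⟨c1, c2, -, -⟩ := torusGlue_cases T₀ T₁ h
  cases s
  · exact c1
  · exact c2

theorem glueTori_side' (s : Bool) :
    (glueTori T₀ T₁ h).glue (T₁.side s).1 ((T₁.side s).2 3) =
      some ((T₀.side s).1, (T₀.side s).2 * (T₁.side s).2⁻¹) := by
  obtain ⟨-, -, c3, c4⟩ := torusGlue_cases T₀ T₁ h
  cases s
  · exact c3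
  · exact c4

theorem glueTori_of_notMem {t : X.Tet} {k : Fin 4} (h₀ : (t, k) ∉ T₀.faces)
    (h₁ : (t, k) ∉ T₁.faces) : (glueTori T₀ T₁ h).glue t k = X.glue t k := by
  change torusGlue T₀ T₁ t k = _
  have hp₀ : (t, k) ≠ T₀.p.face := fun e => h₀ (Or.inl e)
  have hq₀ : (t, k) ≠ T₀.q.face := fun e => h₀ (Or.inr e)
  have hp₁ : (t, k) ≠ T₁.p.face := fun e => h₁ (Or.inl e)
  have hq₁ : (t, k) ≠ T₁.q.face := fun e => h₁ (Or.inr e)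
  rw [torusGlue, if_neg hp₀, if_neg hq₀, if_neg hp₁, if_neg hq₁]

theorem glueTori_cases {t t' : X.Tet} {k : Fin 4} {σ : Perm (Fin 4)}
    (e : (glueTori T₀ T₁ h).glue t k = some (t', σ)) :
    X.glue t k = some (t', σ) ∨
    (∃ s, t = (T₀.side s).1 ∧ k = (T₀.side s).2 3 ∧ t' = (T₁.side s).1 ∧
      σ = (T₁.side s).2 * (T₀.side s).2⁻¹) ∨
    (∃ s, t = (T₁.side s).1 ∧ k = (T₁.side s).2 3 ∧ t' = (T₀.side s).1 ∧
      σ = (T₀.side s).2 * (T₁.side s).2⁻¹) := by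
  by_cases h₀ : (t, k) ∈ T₀.faces
  · obtain ⟨s, hs⟩ := T₀.mem_faces_iff.1 h₀
    simp only [LFace.face, Prod.mk.injEq] at hs
    obtain ⟨rfl, rfl⟩ := hs
    have e' := Option.some.inj ((glueTori_side h s).symm.trans e)
    exact Or.inr (Or.inl ⟨s, rfl, rfl, (congrArg Prod.fst e').symm, (congrArg Prod.snd e').symm⟩)
  by_cases h₁ : (t, k) ∈ T₁.faces
  · obtain ⟨s, hs⟩ := T₁.mem_faces_iff.1 h₁
    simp only [LFace.face, Prod.mk.injEq] at hs
    obtain ⟨rfl, rfl⟩ := hs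
    have e' := Option.some.inj ((glueTori_side' h s).symm.trans e)
    exact Or.inr (Or.inr ⟨s, rfl, rfl, (congrArg Prod.fst e').symm, (congrArg Prod.snd e').symm⟩)
  · exact Or.inl ((glueTori_of_notMem h h₀ h₁).symm.trans e)

theorem glueTori_isBoundary {f : X.Tet × Fin 4} : (glueTori T₀ T₁ h).IsBoundary (emb h f) ↔
    X.IsBoundary f ∧ f ∉ T₀.faces ∧ f ∉ T₁.faces := by
  by_cases h₀ : f ∈ T₀.faces
  · obtain ⟨s, rfl⟩ := T₀.mem_faces_iff.1 h₀
    simp only [h₀, not_true_eq_false, and_false, false_and, iff_false]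
    intro e
    exact Option.some_ne_none _ ((glueTori_side h s).symm.trans e)
  by_cases h₁ : f ∈ T₁.faces
  · obtain ⟨s, rfl⟩ := T₁.mem_faces_iff.1 h₁
    simp only [h₁, not_true_eq_false, and_false, iff_false]
    intro e
    exact Option.some_ne_none _ ((glueTori_side' h s).symm.trans e)
  · simp only [h₀, h₁, not_false_eq_true, and_true]
    exact Eq.congr_left (glueTori_of_notMem h h₀ h₁)

theorem glueTori_edgeStep {a b : X.Tet × Fin 4 × Fin 4}
    (e : (glueTori T₀ T₁ h).EdgeStep (emb h a) (emb h b)) :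
    X.EdgeStep a b ∨
    (∃ s i j, i ≠ 3 ∧ j ≠ 3 ∧ a = (T₀.side s).edge i j ∧ b = (T₁.side s).edge i j) ∨
    (∃ s i j, i ≠ 3 ∧ j ≠ 3 ∧ b = (T₀.side s).edge i j ∧ a = (T₁.side s).edge i j) := by
  obtain ⟨t, i, j⟩ := a
  obtain ⟨t', x⟩ := b
  obtain ⟨k, σ, hi, hj, hg, he⟩ := e
  change x = (σ i, σ j) at he
  change k ≠ i at hi
  change k ≠ j at hj
  subst he
  have key : ∀ {l : Perm (Fin 4)} {i : Fin 4}, l 3 ≠ i → l⁻¹ i ≠ 3 := by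
    rintro l i hi e
    exact hi (by rw [← e]; simp)
  rcases glueTori_cases h hg with hg' | ⟨s, rfl, rfl, rfl, rfl⟩ | ⟨s, rfl, rfl, rfl, rfl⟩
  · exact Or.inl ⟨k, σ, hi, hj, hg', rfl⟩
  · exact Or.inr (Or.inl ⟨s, _, _, key hi, key hj, by simp [LFace.edge], rfl⟩)
  · exact Or.inr (Or.inr ⟨s, _, _, key hi, key hj, rfl, by simp [LFace.edge]⟩)

theorem glueTori_edgeEqv_side (s : Bool) {i j : Fin 4} (hi : i ≠ 3) (hj : j ≠ 3) :
    (glueTori T₀ T₁ h).EdgeEqv (emb h ((T₀.side s).edge i j)) (emb h ((T₁.side s).edge i j)) :=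
  .rel _ _ ⟨(T₀.side s).2 3, (T₁.side s).2 * (T₀.side s).2⁻¹,
    (T₀.side s).2.injective.ne hi.symm, (T₀.side s).2.injective.ne hj.symm,
    glueTori_side h s, by simp [emb, LFace.edge]⟩

theorem EdgeEqv.emb {a b : X.Tet × Fin 4 × Fin 4} (e : X.EdgeEqv a b) :
    (glueTori T₀ T₁ h).EdgeEqv (emb h a) (emb h b) :=
  EdgeEqv.map (X := X) (Y := glueTori T₀ T₁ h) (fun t => t)
    (fun _ _ _ _ => glueTori_of_glue h) e

/-- The edges `a` and `b` are identified by the gluing of the tori. -/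
def Matched (T₀ T₁ : X.OneVertexTorus) (a b : X.Tet × Fin 4 × Fin 4) : Prop :=
  ∃ s i j, i ≠ 3 ∧ j ≠ 3 ∧ X.EdgeEqv a ((T₀.side s).edge i j) ∧ X.EdgeEqv b ((T₁.side s).edge i j)

theorem Matched.edgeEqv {a b : X.Tet × Fin 4 × Fin 4} (e : Matched T₀ T₁ a b) :
    (glueTori T₀ T₁ h).EdgeEqv (Triangulation.emb h a) (Triangulation.emb h b) := by
  obtain ⟨s, i, j, hi, hj, ha, hb⟩ := e
  exact ((ha.emb h).trans (glueTori_edgeEqv_side h s hi hj)).trans (hb.emb h).symm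

theorem Matched.vertexEqv {a b : X.Tet × Fin 4 × Fin 4} (e : Matched T₀ T₁ a b) :
    X.VertexEqv (a.1, a.2.1) T₀.base ∧ X.VertexEqv (b.1, b.2.1) T₁.base := by
  obtain ⟨s, i, j, hi, hj, ha, hb⟩ := e
  exact ⟨ha.vertexEqv.trans (T₀.vertexEqv_base s hi), hb.vertexEqv.trans (T₁.vertexEqv_base s hi)⟩

/-- One passage between the tori suffices. Passing back gives nothing new, because the edges of both
tori are identified among themselves in the same way, and passing twice in the same direction would
identify the two vertices of the tori. -/
theorem glueTori_edgeEqv (hX : X.IsManifold) {a b : X.Tet × Fin 4 × Fin 4} :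
    (glueTori T₀ T₁ h).EdgeEqv (emb h a) (emb h b) ↔
      X.EdgeEqv a b ∨ Matched T₀ T₁ a b ∨ Matched T₀ T₁ b a := by
  refine ⟨fun e => ?_, ?_⟩
  · have hb := OneVertexTorus.not_vertexEqv_base hX h
    refine Relation.EqvGen.imp_of_step (r := (glueTori T₀ T₁ h).EdgeStep) (P := fun c =>
      X.EdgeEqv a c ∨ Matched T₀ T₁ a c ∨ Matched T₀ T₁ c a) (fun _ _ => EdgeStep.symm) ?_ e
      (Or.inl (.refl _))
    intro b c hbc hab
    rcases glueTori_edgeStep h (a := b) (b := c) hbc with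
      hbc | ⟨s, i, j, hi, hj, rfl, rfl⟩ | ⟨s, i, j, hi, hj, rfl, rfl⟩
    · have hbc' : X.EdgeEqv b c := .rel _ _ hbc
      rcases hab with hab | ⟨s, i, j, hi, hj, h0, h1⟩ | ⟨s, i, j, hi, hj, h0, h1⟩
      · exact Or.inl (hab.trans hbc')
      · exact Or.inr (Or.inl ⟨s, i, j, hi, hj, h0, hbc'.symm.trans h1⟩)
      · exact Or.inr (Or.inr ⟨s, i, j, hi, hj, hbc'.symm.trans h0, h1⟩)
    · rcases hab with hab | hab | ⟨s', i', j', hi', hj', h0, h1⟩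
      · exact Or.inr (Or.inl ⟨s, i, j, hi, hj, hab, .refl _⟩)
      · exact absurd ((T₀.vertexEqv_base s hi).symm.trans hab.vertexEqv.2) hb
      · exact Or.inl (h1.trans
          (OneVertexTorus.edgeEqv_transfer T₀ T₁ hi hj hi' hj' h0).symm)
    · rcases hab with hab | ⟨s', i', j', hi', hj', h0, h1⟩ | hab
      · exact Or.inr (Or.inr ⟨s, i, j, hi, hj, .refl _, hab⟩)
      · exact Or.inl (h0.trans
          (OneVertexTorus.edgeEqv_transfer T₁ T₀ hi hj hi' hj' h1).symm)
      · exact absurd (hab.vertexEqv.1.symm.trans (T₁.vertexEqv_base s hi)) hb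
  · rintro (e | e | e)
    · exact e.emb h
    · exact e.edgeEqv h
    · exact (e.edgeEqv h).symm

theorem VertexEqv.emb {a b : X.Tet × Fin 4} (e : X.VertexEqv a b) :
    (glueTori T₀ T₁ h).VertexEqv (emb h a) (emb h b) :=
  (e.edgeEqv.emb h).vertexEqv

theorem glueTori_vertexEqv_base :
    (glueTori T₀ T₁ h).VertexEqv (emb h T₀.base) (emb h T₁.base) :=
  (glueTori_edgeEqv_side h false (i := 0) (j := 0) (by decide) (by decide)).vertexEqv

theorem glueTori_vertexEqv (hX : X.IsManifold) {a b : X.Tet × Fin 4} :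
    (glueTori T₀ T₁ h).VertexEqv (emb h a) (emb h b) ↔ X.VertexEqv a b ∨
      (X.VertexEqv a T₀.base ∧ X.VertexEqv b T₁.base) ∨
      (X.VertexEqv b T₀.base ∧ X.VertexEqv a T₁.base) := by
  constructor
  · intro e
    exact ((glueTori_edgeEqv h hX (a := (a.1, a.2, a.2)) (b := (b.1, b.2, b.2))).1 e.edgeEqv).imp
      EdgeEqv.vertexEqv (Or.imp Matched.vertexEqv Matched.vertexEqv)
  · rintro (e | ⟨e, e'⟩ | ⟨e, e'⟩)
    · exact e.emb h
    · exact ((e.emb h).trans (glueTori_vertexEqv_base h)).trans (e'.emb h).symm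
    · exact ((e'.emb h).trans (glueTori_vertexEqv_base h).symm).trans (e.emb h).symm

theorem glueTori_cornerSetoid {a b : X.Tet × Fin 4 × Fin 4} :
    (glueTori T₀ T₁ h).cornerSetoid (emb h a) (emb h b) ↔ X.cornerSetoid a b ∨
      (∃ s i, a = (T₀.side s).edge i 3 ∧ b = (T₁.side s).edge i 3) ∨
      (∃ s i, b = (T₀.side s).edge i 3 ∧ a = (T₁.side s).edge i 3) := by
  rw [cornerSetoid_iff, cornerSetoid_iff, (emb_injective h).eq_iff, or_assoc]
  refine or_congr Iff.rfl ⟨?_, ?_⟩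
  · obtain ⟨t, i, k⟩ := a
    obtain ⟨t', x⟩ := b
    rintro ⟨σ, hg, he⟩
    change x = (σ i, σ k) at he
    subst he
    rcases glueTori_cases h hg with hg' | ⟨s, e1, e2, e3, rfl⟩ | ⟨s, e1, e2, e3, rfl⟩
    · exact Or.inl ⟨σ, hg', rfl⟩
    · change k = _ at e2
      subst e1 e2 e3
      exact Or.inr (Or.inl ⟨s, (T₀.side s).2⁻¹ i, by simp [LFace.edge], by simp [LFace.edge]⟩)
    · change k = _ at e2
      subst e1 e2 e3
      exact Or.inr (Or.inr ⟨s, (T₁.side s).2⁻¹ i, by simp [LFace.edge], by simp [LFace.edge]⟩)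
  · rintro (⟨σ, hg, he⟩ | ⟨s, i, rfl, rfl⟩ | ⟨s, i, rfl, rfl⟩)
    · exact ⟨σ, glueTori_of_glue h hg, he⟩
    · exact ⟨_, glueTori_side h s, by simp [emb, LFace.edge]⟩
    · exact ⟨_, glueTori_side' h s, by simp [emb, LFace.edge]⟩

/-! ### Links after gluing -/

theorem glueTori_vertexEqv_of_not (hX : X.IsManifold) {v : X.Tet × Fin 4}
    (h₀ : ¬ X.VertexEqv v T₀.base) (h₁ : ¬ X.VertexEqv v T₁.base) {a : X.Tet × Fin 4} :
    (glueTori T₀ T₁ h).VertexEqv (emb h a) (emb h v) ↔ X.VertexEqv a v := by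
  rw [glueTori_vertexEqv h hX]
  tauto

theorem glueTori_vertexEqv_base_iff (hX : X.IsManifold) {a : X.Tet × Fin 4} :
    (glueTori T₀ T₁ h).VertexEqv (emb h a) (emb h T₀.base) ↔
      X.VertexEqv a T₀.base ∨ X.VertexEqv a T₁.base := by
  have hb := OneVertexTorus.not_vertexEqv_base hX h
  have hr := VertexEqv.refl T₀.base
  rw [glueTori_vertexEqv h hX]
  tauto

/-- In the star of a vertex, edges are not identified by the gluing of the tori. -/
theorem mk_glueTori_edge_iff (hX : X.IsManifold) {v : X.Tet × Fin 4}
    {a b : X.Tet × Fin 4 × Fin 4} (ha : a ∈ X.star v) (hb : b ∈ X.star v) :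
    Quotient.mk (glueTori T₀ T₁ h).edgeSetoid (emb h a) =
        Quotient.mk (glueTori T₀ T₁ h).edgeSetoid (emb h b) ↔
      Quotient.mk X.edgeSetoid a = Quotient.mk X.edgeSetoid b := by
  refine Quotient.eq.trans (Iff.trans ?_ Quotient.eq.symm)
  refine (glueTori_edgeEqv h hX).trans (or_iff_left ?_)
  have hn := OneVertexTorus.not_vertexEqv_base hX h
  rintro (e | e)
  · exact hn (e.vertexEqv.1.symm.trans (ha.2.trans (hb.2.symm.trans e.vertexEqv.2)))
  · exact hn (e.vertexEqv.1.symm.trans (hb.2.trans (ha.2.symm.trans e.vertexEqv.2)))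

theorem vertexEqv_of_edge_mem_star {T : X.OneVertexTorus} {v : X.Tet × Fin 4} {s : Bool}
    {i : Fin 4} (ha : (T.side s).edge i 3 ∈ X.star v) : X.VertexEqv v T.base := by
  have hi : i ≠ 3 := fun e => ha.1 (congrArg (T.side s).2 e)
  exact ha.2.symm.trans (T.vertexEqv_base s hi)

theorem mk_glueTori_corner_iff (hX : X.IsManifold) {v : X.Tet × Fin 4}
    {a b : X.Tet × Fin 4 × Fin 4} (ha : a ∈ X.star v) (hb : b ∈ X.star v) :
    Quotient.mk (glueTori T₀ T₁ h).cornerSetoid (emb h a) =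
        Quotient.mk (glueTori T₀ T₁ h).cornerSetoid (emb h b) ↔
      Quotient.mk X.cornerSetoid a = Quotient.mk X.cornerSetoid b := by
  refine Quotient.eq.trans (Iff.trans ?_ Quotient.eq.symm)
  refine (glueTori_cornerSetoid h).trans (or_iff_left ?_)
  have hn := OneVertexTorus.not_vertexEqv_base hX h
  rintro (⟨s, i, rfl, rfl⟩ | ⟨s, i, rfl, rfl⟩)
  · exact hn ((vertexEqv_of_edge_mem_star ha).symm.trans (vertexEqv_of_edge_mem_star hb))
  · exact hn ((vertexEqv_of_edge_mem_star hb).symm.trans (vertexEqv_of_edge_mem_star ha))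

theorem linkEuler_glueTori_of_not (hX : X.IsManifold) {v : X.Tet × Fin 4}
    (h₀ : ¬ X.VertexEqv v T₀.base) (h₁ : ¬ X.VertexEqv v T₁.base) :
    (glueTori T₀ T₁ h).linkEuler (emb h v) = X.linkEuler v := by
  have hs : (glueTori T₀ T₁ h).star (emb h v) = emb h '' X.star v := by
    ext a
    obtain ⟨a, rfl⟩ := emb_surjective h a
    rw [(emb_injective h).mem_set_image]
    exact and_congr Iff.rfl (glueTori_vertexEqv_of_not h hX h₀ h₁ (a := (a.1, a.2.1)))
  have ht : (glueTori T₀ T₁ h).linkTriangles (emb h v) = emb h '' X.linkTriangles v := by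
    ext a
    obtain ⟨a, rfl⟩ := emb_surjective h a
    rw [(emb_injective h).mem_set_image]
    exact glueTori_vertexEqv_of_not h hX h₀ h₁
  rw [linkEuler, linkEuler, linkEdges_eq, linkEdges_eq, linkVertices_eq, linkVertices_eq, hs, ht,
    Set.image_image, Set.image_image,
    Set.ncard_image_eq_ncard_image fun a ha b hb => mk_glueTori_edge_iff h hX ha hb,
    Set.ncard_image_eq_ncard_image fun a ha b hb => mk_glueTori_corner_iff h hX ha hb,
    Set.ncard_image_of_injective _ (emb_injective h)]

/-- The new link is the union of two discs along their boundary circles, and the count is inclusion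
and exclusion with `Set.ncard_image_union_add`. -/
theorem linkEuler_glueTori (hX : X.IsManifold) :
    (glueTori T₀ T₁ h).linkEuler (emb h T₀.base) = 2 := by
  have := X.finite
  have hn := OneVertexTorus.not_vertexEqv_base hX h
  have hs : (glueTori T₀ T₁ h).star (emb h T₀.base) =
      emb h '' (X.star T₀.base ∪ X.star T₁.base) := by
    ext a
    obtain ⟨a, rfl⟩ := emb_surjective h a
    rw [(emb_injective h).mem_set_image]
    exact (and_congr Iff.rfl
      (glueTori_vertexEqv_base_iff h hX (a := (a.1, a.2.1)))).trans and_or_left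
  have ht : (glueTori T₀ T₁ h).linkTriangles (emb h T₀.base) =
      emb h '' (X.linkTriangles T₀.base ∪ X.linkTriangles T₁.base) := by
    ext a
    obtain ⟨a, rfl⟩ := emb_surjective h a
    rw [(emb_injective h).mem_set_image]
    exact glueTori_vertexEqv_base_iff h hX
  -- The common vertices are the ends of the three edges of the torus; all six oriented edges occur
  -- on the single face `side false`, so these serve as representatives.
  have hE : ((glueTori T₀ T₁ h).linkVertices (emb h T₀.base)).ncard + 6 =
      (X.linkVertices T₀.base).ncard + (X.linkVertices T₁.base).ncard := by
    rw [linkVertices_eq, linkVertices_eq, linkVertices_eq, hs, Set.image_image,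
      ← T₀.ncard_edges]
    refine Set.ncard_image_union_add (fun a ha b hb => mk_glueTori_edge_iff h hX ha hb)
      (fun a ha b hb => mk_glueTori_edge_iff h hX ha hb) ?_ ?_ ?_ ?_
    · rintro _ ⟨⟨i, j⟩, ⟨hi, hj, hij⟩, rfl⟩
      exact ⟨(T₀.side false).2.injective.ne hij, T₀.vertexEqv_base false hi⟩
    · rintro _ ⟨⟨i, j⟩, ⟨hi, hj, hij⟩, rfl⟩ _ ⟨⟨i', j'⟩, ⟨hi', hj', hij'⟩, rfl⟩ e
      obtain ⟨e1, e2⟩ := T₀.edge_injective hi hj hij hi' hj' hij' (Quotient.exact e)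
      exact congrArg₂ (fun a b => (T₀.side false).edge a b) e1 e2
    · intro a ha b hb e
      rcases (glueTori_edgeEqv h hX).1 (Quotient.exact e) with e | e | e
      · exact absurd (ha.2.symm.trans (e.vertexEqv.trans hb.2)) hn
      · obtain ⟨s, i, j, hi, hj, e, -⟩ := e
        have hij : i ≠ j := fun hij => ha.1 (e.eq_iff_eq.2 (congrArg (T₀.side s).2 hij))
        cases s
        · exact ⟨_, ⟨(i, j), ⟨hi, hj, hij⟩, rfl⟩, Quotient.sound (e.emb h)⟩
        · exact ⟨_, ⟨OneVertexTorus.mate i j, OneVertexTorus.mate_ne hi hj hij, rfl⟩,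
            Quotient.sound ((e.trans (T₀.edgeEqv_mate true hi hj hij)).emb h)⟩
      · exact absurd (e.vertexEqv.1.symm.trans hb.2) hn
    · rintro _ ⟨⟨i, j⟩, ⟨hi, hj, hij⟩, rfl⟩
      exact ⟨(T₁.side false).edge i j, ⟨(T₁.side false).2.injective.ne hij,
        T₁.vertexEqv_base false hi⟩, Quotient.sound (glueTori_edgeEqv_side h false hi hj)⟩
  -- The common edges are the three corners of each of the two glued faces.
  have hC : ((glueTori T₀ T₁ h).linkEdges (emb h T₀.base)).ncard + 6 =
      (X.linkEdges T₀.base).ncard + (X.linkEdges T₁.base).ncard := by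
    rw [linkEdges_eq, linkEdges_eq, linkEdges_eq, hs, Set.image_image, ← T₀.ncard_corners]
    refine Set.ncard_image_union_add (fun a ha b hb => mk_glueTori_corner_iff h hX ha hb)
      (fun a ha b hb => mk_glueTori_corner_iff h hX ha hb) ?_ ?_ ?_ ?_
    · rintro ⟨t, i, k⟩ ⟨h1, h2⟩
      exact ⟨h1, T₀.vertexEqv_of_mem_faces h2 h1⟩
    · intro a ha b hb e
      rcases cornerSetoid_iff.1 (Quotient.exact e) with e | ⟨σ, hg, -⟩
      · exact e
      · rw [show X.glue a.1 a.2.2 = none from T₀.boundary_of_mem_faces ha.2] at hg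
        simp at hg
    · intro a ha b hb e
      rcases (glueTori_cornerSetoid h).1 (Quotient.exact e) with e | ⟨s, i, rfl, -⟩ | ⟨s, i, rfl, -⟩
      · rcases cornerSetoid_iff.1 e with rfl | ⟨σ, hg, he⟩
        · exact absurd (ha.2.symm.trans hb.2) hn
        · have e' : X.VertexEqv (a.1, a.2.1) (b.1, b.2.1) :=
            .rel _ _ ⟨a.2.2, σ, ha.1.symm, hg, by rw [he]⟩
          exact absurd (ha.2.symm.trans (e'.trans hb.2)) hn
      · exact ⟨_, ⟨ha.1, T₀.side_mem_faces s⟩, rfl⟩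
      · exact absurd (vertexEqv_of_edge_mem_star hb).symm hn
    · intro a ha
      obtain ⟨s, i, hi, rfl⟩ := T₀.mem_corners_iff.1 ha
      exact ⟨(T₁.side s).edge i 3, ⟨(T₁.side s).2.injective.ne hi, T₁.vertexEqv_base s hi⟩,
        Quotient.sound ((glueTori_cornerSetoid h).2 (Or.inr (Or.inl ⟨s, i, rfl, rfl⟩)))⟩
  have hF : ((glueTori T₀ T₁ h).linkTriangles (emb h T₀.base)).ncard =
      (X.linkTriangles T₀.base).ncard + (X.linkTriangles T₁.base).ncard := by
    rw [ht, Set.ncard_image_of_injective _ (emb_injective h),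
      Set.ncard_union_eq ?_ (Set.toFinite _) (Set.toFinite _)]
    rw [Set.disjoint_left]
    exact fun a ha hb => hn (ha.symm.trans hb)
  have e0 := (OneVertexTorus.linkIsDisc hX (.refl T₀.base)).2.2
  have e1 := (OneVertexTorus.linkIsDisc hX (.refl T₁.base)).2.2
  rw [linkEuler] at e0 e1 ⊢
  omega

/-- Gluing two one-vertex tori in the boundary gives a manifold again. -/
theorem glueTori_isManifold (hX : X.IsManifold) : (glueTori T₀ T₁ h).IsManifold := by
  have hn := OneVertexTorus.not_vertexEqv_base hX h
  constructor
  · intro t i j hij e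
    -- If an edge were matched with its own reverse, one of its endpoints would be identified with
    -- the vertices of both tori.
    rcases (glueTori_edgeEqv h hX (a := (t, i, j)) (b := (t, j, i))).1 e with
      e | ⟨s, a, b, ha, hb, e0, e1⟩ | ⟨s, a, b, ha, hb, e0, e1⟩
    · exact hX.1 _ _ _ hij e
    · exact hn ((T₀.vertexEqv_base s hb).symm.trans
        ((e0.reverse.vertexEqv.symm.trans e1.vertexEqv).trans (T₁.vertexEqv_base s ha)))
    · exact hn ((T₀.vertexEqv_base s hb).symm.trans
        ((e0.reverse.vertexEqv.symm.trans e1.vertexEqv).trans (T₁.vertexEqv_base s ha)))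
  · intro v
    obtain ⟨v, rfl⟩ := emb_surjective h v
    by_cases hv : X.VertexEqv v T₀.base ∨ X.VertexEqv v T₁.base
    · rw [((glueTori_vertexEqv_base_iff h hX).2 hv).link_congr]
      refine Or.inl ⟨?_, linkEuler_glueTori h hX⟩
      rw [Set.eq_empty_iff_forall_notMem]
      intro a
      obtain ⟨⟨t, i, k⟩, rfl⟩ := emb_surjective h a
      rintro ⟨h1, h2, h3⟩
      obtain ⟨h3, h4, h5⟩ := (glueTori_isBoundary h (f := (t, k))).1 h3
      rcases (glueTori_vertexEqv_base_iff h hX (a := (t, i))).1 h2 with h2 | h2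
      · have h6 : (t, i, k) ∈ X.linkBoundary T₀.base := ⟨h1, h2, h3⟩
        rw [OneVertexTorus.linkBoundary_eq hX (.refl _)] at h6
        exact h4 h6.2
      · have h6 : (t, i, k) ∈ X.linkBoundary T₁.base := ⟨h1, h2, h3⟩
        rw [OneVertexTorus.linkBoundary_eq hX (.refl _)] at h6
        exact h5 h6.2
    · rw [not_or] at hv
      obtain ⟨h₀, h₁⟩ := hv
      have hB : (glueTori T₀ T₁ h).linkBoundary (emb h v) = emb h '' X.linkBoundary v := by
        ext a
        obtain ⟨⟨t, i, k⟩, rfl⟩ := emb_surjective h a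
        rw [(emb_injective h).mem_set_image]
        refine and_congr_right fun hik => ?_
        refine (and_congr (glueTori_vertexEqv_of_not h hX h₀ h₁ (a := (t, i)))
          (glueTori_isBoundary h (f := (t, k)))).trans (and_congr_right fun hv => ?_)
        refine and_iff_left ⟨fun hf => ?_, fun hf => ?_⟩
        · exact h₀ (hv.symm.trans (T₀.vertexEqv_of_mem_faces hf hik))
        · exact h₁ (hv.symm.trans (T₁.vertexEqv_of_mem_faces hf hik))
      refine (hX.2 v).imp (fun hs => ⟨?_, ?_⟩) (fun hd => ⟨?_, ?_, ?_⟩)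
      · rw [hB, hs.1, Set.image_empty]
      · rw [linkEuler_glueTori_of_not h hX h₀ h₁, hs.2]
      · rw [hB]
        exact hd.1.image _
      · rw [hB]
        rintro _ ⟨c, hc, rfl⟩ _ ⟨d, hd', rfl⟩
        refine LinkBoundaryAdj.map (X := X) (Y := glueTori T₀ T₁ h) (fun t => t)
          (fun _ _ _ _ => glueTori_of_glue h) (fun c hc => ?_) (hd.2.1 c hc d hd')
        rw [hB]
        exact ⟨c, hc, rfl⟩
      · rw [linkEuler_glueTori_of_not h hX h₀ h₁, hd.2.2]

/-- The condition on the faces `p` implies the same for the faces `q`, because the two faces of each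
torus have opposite signs. -/
theorem glueTori_isOrientation {o : X.Tet → ℤˣ} (ho : X.IsOrientation o)
    (hs : T₁.p.sgn o = - T₀.p.sgn o) : (glueTori T₀ T₁ h).IsOrientation o := by
  have hs' : ∀ s, (T₁.side s).sgn o = - (T₀.side s).sgn o := by
    rintro (_ | _)
    · exact hs
    · change T₁.q.sgn o = - T₀.q.sgn o
      rw [T₁.sgn_side ho, T₀.sgn_side ho, hs]
  have key : ∀ {l m : X.LFace}, m.sgn o = - l.sgn o →
      o m.1 = - (Perm.sign (m.2 * l.2⁻¹) * o l.1) := by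
    intro l m e
    simp only [LFace.sgn] at e
    rw [Perm.sign_mul, Perm.sign_inv, mul_assoc, ← mul_neg, ← e, ← mul_assoc,
      Int.units_mul_self, one_mul]
  intro t k t' σ e
  rcases glueTori_cases h e with e | ⟨s, rfl, rfl, rfl, rfl⟩ | ⟨s, rfl, rfl, rfl, rfl⟩
  · exact ho _ _ _ _ e
  · exact key (hs' s)
  · exact key (by rw [hs' s, neg_neg])

end Triangulation

/-! ### The Farey graph -/

/-- The determinant of an automorphism is multiplicative and integral, and so is that of its
inverse; their product is 1, so it is a unit of ℤ. -/
theorem AddEquiv.abs_det (φ : H1 ≃+ H1) (v w : H1) :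
    |(φ v).1 * (φ w).2 - (φ v).2 * (φ w).1| = |v.1 * w.2 - v.2 * w.1| := by
  have key : ∀ ψ : H1 ≃+ H1, ∀ v w : H1, (ψ v).1 * (ψ w).2 - (ψ v).2 * (ψ w).1 =
      ((ψ (1, 0)).1 * (ψ (0, 1)).2 - (ψ (1, 0)).2 * (ψ (0, 1)).1) *
        (v.1 * w.2 - v.2 * w.1) := by
    intro ψ v w
    have lin : ∀ w : H1, ψ w = w.1 • ψ (1, 0) + w.2 • ψ (0, 1) := by
      intro w
      rw [← map_zsmul, ← map_zsmul, ← map_add]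
      congr 1
      ext <;> simp
    rw [lin v, lin w]
    simp only [Prod.fst_add, Prod.snd_add, Prod.smul_fst, Prod.smul_snd, smul_eq_mul]
    ring
  have h1 := key φ
  have h2 := key φ.symm (φ (1, 0)) (φ (0, 1))
  rw [h1 v w, abs_mul]
  simp only [AddEquiv.symm_apply_apply, mul_one, mul_zero, sub_zero] at h2
  rw [mul_comm, Int.isUnit_iff_abs_eq.1 (IsUnit.of_mul_eq_one _ ((mul_comm _ _).trans h2.symm)),
    mul_one]

theorem fareyGraph_adj_map (φ : H1 ≃+ H1) {s t : Slope} (h : fareyGraph.Adj s t) :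
    fareyGraph.Adj (s.map φ) (t.map φ) := by
  obtain ⟨v, w, rfl, rfl, h⟩ := h
  exact ⟨_, _, rfl, rfl, (φ.abs_det _ _).trans h⟩

theorem Slope.map_trans (φ ψ : H1 ≃+ H1) (s : Slope) :
    s.map (φ.trans ψ) = (s.map φ).map ψ := by
  induction s using Quotient.inductionOn
  rfl

theorem Slope.map_refl (s : Slope) : s.map (AddEquiv.refl H1) = s := by
  induction s using Quotient.inductionOn
  rfl

theorem Slope.map_symm_map (φ : H1 ≃+ H1) (s : Slope) : (s.map φ).map φ.symm = s := by
  rw [← Slope.map_trans, AddEquiv.self_trans_symm, Slope.map_refl]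

/-! ### Signs of slopes -/

/-- The product of the coordinates of a slope. -/
def Slope.prod (s : Slope) : ℤ :=
  Quotient.lift (fun v : PrimitiveClass => v.1.1 * v.1.2) (by
    rintro v w (h | h) <;> simp [h]) s

/-- A slope adjacent to a negative one is not positive. -/
theorem Slope.prod_nonpos_of_adj {s t : Slope} (hs : s.prod < 0) (h : fareyGraph.Adj s t) :
    t.prod ≤ 0 := by
  obtain ⟨⟨⟨a, b⟩, hv⟩, ⟨⟨c, d⟩, hw⟩, rfl, rfl, h⟩ := h
  change a * b < 0 at hs
  change c * d ≤ 0
  change |a * d - b * c| = 1 at h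
  by_contra! hcd
  -- This is the product of ab < 0 and cd > 0. So ad and bc are nonzero integers of opposite signs,
  -- and they differ by at least 2.
  have h1 : a * d * (b * c) < 0 := by nlinarith
  rcases mul_neg_iff.1 h1 with ⟨h2, h3⟩ | ⟨h2, h3⟩
  · rw [abs_of_pos (by omega)] at h
    omega
  · rw [abs_of_neg (by omega)] at h
    omega

section

open TorusPair

/-- Flipping the diagonal and rotating the labels: `(a, b) ↦ -(b, a + b)`. -/
def flipRotate : H1 ≃+ H1 := layerH1.trans rotateH1

/-- The new product is b(a + b) = ab + b². -/
theorem Slope.prod_flipRotate_pos {s : Slope} (h : 0 < s.prod) : 0 < (s.map flipRotate).prod := by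
  induction s using Quotient.inductionOn with | h v =>
  obtain ⟨⟨a, b⟩, hv⟩ := v
  change 0 < a * b at h
  change 0 < -b * (-a - b)
  nlinarith [sq_nonneg b]

/-- The inverse of `flipRotate` is (a,b) ↦ (a-b, -a), its square (2a-b, b-a), and the new product
3ab - 2a² - b². A single inverse is not enough: it takes (0,1) to a slope with product zero. This is
why two layerings are spent for each unit of distance. -/
theorem Slope.prod_flipRotate_symm_neg {s : Slope} (h : s.prod ≤ 0) :
    ((s.map flipRotate.symm).map flipRotate.symm).prod < 0 := by
  induction s using Quotient.inductionOn with | h v =>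
  obtain ⟨⟨a, b⟩, hv⟩ := v
  change a * b ≤ 0 at h
  change -(-a - -(b - a)) * -(-(b - a)) < 0
  have h0 : a ≠ 0 ∨ b ≠ 0 := hv.ne_zero_or_ne_zero
  rcases h0 with h0 | h0
  · nlinarith [sq_nonneg b, show 0 < a ^ 2 by positivity]
  · nlinarith [sq_nonneg a, show 0 < b ^ 2 by positivity]

theorem Slope.prod_layer (s : Slope) : (s.map layerH1).prod = - s.prod := by
  induction s using Quotient.inductionOn with | h v =>
  obtain ⟨⟨a, b⟩, hv⟩ := v
  exact neg_mul a b

theorem Slope.prod_exchange (s : Slope) : (s.map exchangeH1).prod = s.prod := by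
  induction s using Quotient.inductionOn with | h v =>
  obtain ⟨⟨a, b⟩, hv⟩ := v
  exact mul_comm b a

/-- The characteristic polynomial of `rotateH1` is x² + x + 1, so neither 1 nor -1 is an eigenvalue.
-/
theorem Slope.map_rotate_ne (s : Slope) : s.map rotateH1 ≠ s := by
  induction s using Quotient.inductionOn with | h v =>
  obtain ⟨⟨a, b⟩, hv⟩ := v
  intro h
  have h0 : a ≠ 0 ∨ b ≠ 0 := hv.ne_zero_or_ne_zero
  rcases Quotient.exact h with h | h
  all_goals
    have h1 := congrArg Prod.fst h
    have h2 := congrArg Prod.snd h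
    simp only [rotateH1, AddEquiv.coe_mk, Equiv.coe_fn_mk, Prod.fst_neg, Prod.snd_neg] at h1 h2
    omega

/-- Every slope is positive after a rotation of the labels. -/
theorem Slope.exists_rotate_pos (s : Slope) : 0 < s.prod ∨ 0 < (s.map rotateH1).prod ∨
    0 < ((s.map rotateH1).map rotateH1).prod := by
  induction s using Quotient.inductionOn with | h v =>
  obtain ⟨⟨a, b⟩, hv⟩ := v
  change 0 < a * b ∨ 0 < -b * (a - b) ∨ 0 < -(a - b) * (-b - (a - b))
  by_contra! h
  obtain ⟨h1, h2, h3⟩ := h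
  have h0 : a ≠ 0 ∨ b ≠ 0 := hv.ne_zero_or_ne_zero
  rcases h0 with h0 | h0
  · nlinarith [sq_nonneg b, show 0 < a ^ 2 by positivity]
  · nlinarith [sq_nonneg a, show 0 < b ^ 2 by positivity]

theorem Slope.map_rotate_three (s : Slope) :
    ((s.map rotateH1).map rotateH1).map rotateH1 = s := by
  induction s using Quotient.inductionOn with | h v =>
  obtain ⟨⟨a, b⟩, hv⟩ := v
  refine Quotient.sound (Or.inl ?_)
  change ((-(-b - (a - b)), -(a - b) - (-b - (a - b))) : H1) = (a, b)
  ext <;> dsimp only <;> ring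

/-! ### Lower bounds for the Farey distance -/

/-- The extended distance is infinite in the absence of walks, so connectedness of the Farey graph
is never needed. -/
theorem SimpleGraph.lt_edist_of_forall_walk {V : Type*} {G : SimpleGraph V} {u v : V} {n : ℕ}
    (h : ∀ w : G.Walk u v, n < w.length) : (n : ℕ∞) < G.edist u v := by
  by_cases hr : G.Reachable u v
  · obtain ⟨w, hw⟩ := hr.exists_walk_length_eq_edist
    rw [← hw]
    exact_mod_cast h w
  · rw [SimpleGraph.edist_eq_top_of_not_reachable hr]
    exact ENat.natCast_lt_top n

def fareyHom (φ : H1 ≃+ H1) : fareyGraph →g fareyGraph where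
  toFun := Slope.map φ
  map_rel' := fareyGraph_adj_map φ

theorem exists_walk_map (φ : H1 ≃+ H1) {s t t' : Slope} (h : t.map φ = t')
    (w : fareyGraph.Walk s t) :
    ∃ w' : fareyGraph.Walk (s.map φ) t', w'.length = w.length := by
  subst h
  exact ⟨w.map (fareyHom φ), SimpleGraph.Walk.length_map _ _⟩

/-- Every path from a negative slope passes through a non-positive one after one step. -/
theorem exists_walk_of_neg {s t : Slope} (hs : s.prod < 0) (w : fareyGraph.Walk s t)
    (h : t.prod ≤ 0 → s ≠ t) :
    ∃ (s' : Slope) (w' : fareyGraph.Walk s' t), s'.prod ≤ 0 ∧ w.length = w'.length + 1 := by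
  cases w with
  | nil => exact absurd rfl (h hs.le)
  | cons ha w' => exact ⟨_, w', Slope.prod_nonpos_of_adj hs ha, rfl⟩

theorem Slope.prod_iterate_pos {t : Slope} (ht : 0 < t.prod) (n : ℕ) :
    0 < ((Slope.map flipRotate)^[n] t).prod := by
  induction n with
  | zero => exact ht
  | succ n ih =>
    rw [Function.iterate_succ_apply']
    exact Slope.prod_flipRotate_pos ih

/-- Pulling the walk back by two flips makes its start negative; after its first edge it is again at
a nonpositive slope, with two flips fewer at its end. Thus every pair of flips costs an edge, and
one more is needed to pass from nonpositive to positive. -/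
theorem lt_length_of_nonpos (n : ℕ) : ∀ {s t : Slope}, s.prod ≤ 0 → 0 < t.prod →
    ∀ w : fareyGraph.Walk s ((Slope.map flipRotate)^[2 * n] t), n < w.length := by
  induction n with
  | zero =>
    intro s t hs ht w
    rw [Nat.pos_iff_ne_zero]
    intro h
    rw [SimpleGraph.Walk.eq_of_length_eq_zero h] at hs
    exact absurd ht hs.not_gt
  | succ n ih =>
    intro s t hs ht w
    have e : ∀ m u, ((Slope.map flipRotate)^[m + 1] u).map flipRotate.symm =
        (Slope.map flipRotate)^[m] u := fun m u => by
      rw [Function.iterate_succ_apply', Slope.map_symm_map]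
    obtain ⟨w₁, hw₁⟩ := exists_walk_map flipRotate.symm (e (2 * n + 1) t) w
    obtain ⟨w₂, hw₂⟩ := exists_walk_map flipRotate.symm (e (2 * n) t) w₁
    obtain ⟨s', w', hs', hw'⟩ := exists_walk_of_neg (Slope.prod_flipRotate_symm_neg hs) w₂
      (fun h => absurd (Slope.prod_iterate_pos ht _) h.not_gt)
    have := ih hs' ht w'
    omega

/-- A negative slope is far from the slopes in the image of the positive ones under many flips. -/
theorem lt_edist_of_neg (n : ℕ) {s t : Slope} (hs : s.prod < 0) (ht : 0 < t.prod) :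
    ((n + 1 : ℕ) : ℕ∞) < fareyGraph.edist s ((Slope.map flipRotate)^[2 * n] t) := by
  refine SimpleGraph.lt_edist_of_forall_walk fun w => ?_
  obtain ⟨s', w', hs', hw'⟩ := exists_walk_of_neg hs w
    (fun h => absurd (Slope.prod_iterate_pos ht _) h.not_gt)
  have := lt_length_of_nonpos n hs' ht w'
  omega

theorem edist_map (φ : H1 ≃+ H1) (s t : Slope) :
    fareyGraph.edist (s.map φ) (t.map φ) = fareyGraph.edist s t := by
  have key : ∀ (ψ : H1 ≃+ H1) (s t : Slope),
      fareyGraph.edist (s.map ψ) (t.map ψ) ≤ fareyGraph.edist s t := by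
    intro ψ s t
    by_cases hr : fareyGraph.Reachable s t
    · obtain ⟨w, hw⟩ := hr.exists_walk_length_eq_edist
      obtain ⟨w', hw'⟩ := exists_walk_map ψ rfl w
      rw [← hw, ← hw']
      exact SimpleGraph.edist_le _
    · rw [SimpleGraph.edist_eq_top_of_not_reachable hr]
      exact le_top
  refine le_antisymm (key φ s t) ?_
  have := key φ.symm (s.map φ) (t.map φ)
  rwa [Slope.map_symm_map, Slope.map_symm_map] at this

end

/-! ### Layering and gluing -/

namespace TorusPair

open Triangulation

theorem LayersTo.numTet {P Q : TorusPair} {n : ℕ} {φ : H1 ≃+ H1} (h : P.LayersTo n Q φ) :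
    Q.X.numTet = P.X.numTet + n := by
  induction h with
  | refl => rfl
  | rotate _ ih => exact ih
  | exchange _ ih => exact ih
  | reverse _ ih => exact ih
  | @layer n Q φ _ ih =>
    have := Q.X.finite
    rw [← add_assoc, ← ih]
    exact Finite.card_option

theorem LayersTo.isManifold {P Q : TorusPair} {n : ℕ} {φ : H1 ≃+ H1} (h : P.LayersTo n Q φ)
    (hP : P.X.IsManifold) : Q.X.IsManifold := by
  induction h with
  | refl => exact hP
  | rotate _ ih => exact ih
  | exchange _ ih => exact ih
  | reverse _ ih => exact ih
  | layer _ ih => exact layer_isManifold ih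

theorem LayersTo.isOrientable {P Q : TorusPair} {n : ℕ} {φ : H1 ≃+ H1} (h : P.LayersTo n Q φ)
    (hP : P.X.IsOrientable) : Q.X.IsOrientable := by
  induction h with
  | refl => exact hP
  | rotate _ ih => exact ih
  | exchange _ ih => exact ih
  | reverse _ ih => exact ih
  | layer _ ih => exact layer_isOrientable ih

/-! ### Compatibility with orientations -/

/-- The tori of the pair can be glued without destroying orientability. -/
def Compatible (P : TorusPair) : Prop :=
  P.X.IsOrientable → ∃ o, P.X.IsOrientation o ∧ P.T₁.p.sgn o = - P.T₀.p.sgn o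

/-- `exchange` replaces `T₀.p` by `T₀.q`, which has the opposite sign. In the non-orientable case
the condition is void. -/
theorem compatible_or_exchange (P : TorusPair) : P.Compatible ∨ P.exchange.Compatible := by
  rw [or_iff_not_imp_left]
  intro h
  simp only [Compatible, not_forall] at h
  obtain ⟨⟨o, ho⟩, h⟩ := h
  refine fun _ => ⟨o, ho, ?_⟩
  change P.T₁.p.sgn o = - P.T₀.q.sgn o
  rw [P.T₀.sgn_side ho, neg_neg]
  by_contra hne
  exact h ⟨o, ho, by
    rcases Int.units_eq_one_or (P.T₁.p.sgn o) with e | e <;>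
    rcases Int.units_eq_one_or (P.T₀.p.sgn o) with e' | e' <;> simp_all⟩

/-- A 3-cycle is even, so rotations remain available after orientations have been matched. -/
theorem sgn_cyc (P : TorusPair) (o : P.X.Tet → ℤˣ) : P.rotate.T₀.p.sgn o = P.T₀.p.sgn o := by
  change (P.T₀.p.relabel OneVertexTorus.cyc).sgn o = _
  rw [LFace.sgn_relabel, show Perm.sign OneVertexTorus.cyc = 1 by decide, one_mul]

theorem Compatible.rotate {P : TorusPair} (h : P.Compatible) : P.rotate.Compatible := by
  intro hP
  obtain ⟨o, ho, e⟩ := h hP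
  exact ⟨o, ho, by rw [sgn_cyc]; exact e⟩

theorem LayersTo.exists_compatible {P Q : TorusPair} {n : ℕ} {φ : H1 ≃+ H1}
    (h : P.LayersTo n Q φ) : ∃ (Q' : TorusPair) (φ' : H1 ≃+ H1), P.LayersTo n Q' φ' ∧
      Q'.Compatible ∧ (φ' = φ ∨ φ' = exchangeH1.trans φ) := by
  rcases Q.compatible_or_exchange with hc | hc
  · exact ⟨Q, φ, h, hc, Or.inl rfl⟩
  · exact ⟨Q.exchange, _, h.exchange, hc, Or.inr rfl⟩

theorem glue_isOrientable {P : TorusPair} (h : P.Compatible) (hP : P.X.IsOrientable) :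
    P.glue.IsOrientable := by
  obtain ⟨o, ho, e⟩ := h hP
  exact ⟨o, glueTori_isOrientation P.disjoint ho e⟩

/-! ### Choice of layerings and of the gluing map -/

/-- Repeated layering, each time after a rotation of the labels. -/
theorem LayersTo.iterate {P Q : TorusPair} {m : ℕ} {φ : H1 ≃+ H1} (h : P.LayersTo m Q φ) (n : ℕ) :
    ∃ (Q' : TorusPair) (ψ : H1 ≃+ H1), P.LayersTo (m + n) Q' ψ ∧
      ∀ s : Slope, s.map ψ = ((Slope.map flipRotate)^[n] s).map φ := by
  induction n with
  | zero => exact ⟨Q, φ, h, fun _ => rfl⟩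
  | succ n ih =>
    obtain ⟨Q', ψ, h', e⟩ := ih
    refine ⟨_, _, h'.rotate.layer, fun s => ?_⟩
    rw [Function.iterate_succ_apply, ← e, flipRotate]
    simp only [Slope.map_trans]

/-- Labels in which a given slope of the first torus is positive. -/
theorem exists_pos_map_eq (P : TorusPair) (α : Slope) :
    ∃ (Q : TorusPair) (φ : H1 ≃+ H1) (β : Slope), P.LayersTo 0 Q φ ∧ 0 < β.prod ∧
      β.map φ = α := by
  rcases α.exists_rotate_pos with h | h | h
  · exact ⟨_, _, α, .refl, h, Slope.map_refl α⟩
  · exact ⟨_, _, _, LayersTo.refl.rotate.rotate, h, by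
      simp only [Slope.map_trans, Slope.map_refl, Slope.map_rotate_three]⟩
  · exact ⟨_, _, _, LayersTo.refl.rotate, h, by
      simp only [Slope.map_trans, Slope.map_refl, Slope.map_rotate_three]⟩

/-- Labels in which a given slope of the second torus is positive. -/
theorem LayersTo.exists_map_eq_pos {P Q : TorusPair} {n : ℕ} {φ : H1 ≃+ H1}
    (h : P.LayersTo n Q φ) (hQ : Q.Compatible) (α : Slope) :
    ∃ (Q' : TorusPair) (φ' : H1 ≃+ H1) (γ : Slope), P.LayersTo n Q' φ' ∧ Q'.Compatible ∧
      0 < γ.prod ∧ α.map φ' = γ.map φ := by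
  rcases α.exists_rotate_pos with hα | hα | hα
  · exact ⟨_, _, _, h, hQ, hα, rfl⟩
  · exact ⟨_, _, _, h.rotate, hQ.rotate, hα, Slope.map_trans _ _ _⟩
  · exact ⟨_, _, _, h.rotate.rotate, hQ.rotate.rotate, hα, by simp only [Slope.map_trans]⟩

theorem exists_compatible_lt_edist (P : TorusPair) (α₀ α₁ : Slope) (D : ℕ) :
    ∃ (Q : TorusPair) (φ : H1 ≃+ H1), P.LayersTo (2 * D) Q φ ∧ Q.Compatible ∧
      (D : ℕ∞) < fareyGraph.edist α₀ (α₁.map φ) := by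
  cases D with
  | zero =>
    obtain ⟨Q, φ, h, hc, -⟩ := (LayersTo.refl (P := P)).exists_compatible
    -- Nothing is layered here; if the slopes happen to coincide, the gluing map is changed by a
    -- rotation, which fixes no slope.
    by_cases hα : α₀ = α₁.map φ
    · refine ⟨_, _, h.rotate, hc.rotate, ?_⟩
      rw [Nat.cast_zero]
      refine SimpleGraph.edist_pos_of_ne fun e => α₁.map_rotate_ne ?_
      rw [Slope.map_trans, hα] at e
      rw [← Slope.map_symm_map φ (α₁.map rotateH1), ← e, Slope.map_symm_map]
    · refine ⟨_, _, h, hc, ?_⟩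
      rw [Nat.cast_zero]
      exact SimpleGraph.edist_pos_of_ne hα
  | succ d =>
    obtain ⟨Q₀, φ₀, β, h₀, hβ, rfl⟩ := P.exists_pos_map_eq α₀
    -- The first tetrahedron is layered without a rotation, so that its flip makes the positive
    -- slope `β` negative. Of the 2d + 1 remaining flips, one keeps the image of `α₁` positive and
    -- 2d give the distance.
    obtain ⟨Q₁, φ₁, h₁, e₁⟩ := h₀.layer.iterate (2 * d + 1)
    rw [show 0 + 1 + (2 * d + 1) = 2 * (d + 1) by ring] at h₁
    obtain ⟨Q₂, φ₂, h₂, hc₂, e₂⟩ := h₁.exists_compatible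
    obtain ⟨Q₃, φ₃, γ, h₃, hc₃, hγ, e₃⟩ := h₂.exists_map_eq_pos hc₂ α₁
    -- The exchange made for the sake of orientation preserves the product of the coordinates, so it
    -- can be absorbed into the slope.
    have key : ∃ γ' : Slope, 0 < γ'.prod ∧ γ.map φ₂ = γ'.map φ₁ := by
      rcases e₂ with rfl | rfl
      · exact ⟨γ, hγ, rfl⟩
      · exact ⟨γ.map exchangeH1, by rwa [Slope.prod_exchange], Slope.map_trans _ _ _⟩
    obtain ⟨γ', hγ', e⟩ := key
    refine ⟨Q₃, φ₃, h₃, hc₃, ?_⟩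
    -- The common map `φ₀` is cancelled, and the involution `layerH1` of the first flip is moved to
    -- the side of `β`.
    rw [e₃, e, e₁, Slope.map_trans, edist_map, ← edist_map layerH1,
      Function.iterate_succ_apply, ← Slope.map_trans _ layerH1,
      show layerH1.trans layerH1 = AddEquiv.refl H1 by ext v <;> simp [layerH1], Slope.map_refl]
    refine lt_edist_of_neg d ?_ (Slope.prod_flipRotate_pos hγ')
    rw [Slope.prod_layer]
    omega

end TorusPair

theorem mainTheorem11 (X : Triangulation) (hX : X.IsManifold) (T₀ T₁ : X.OneVertexTorus)
    (hT : Disjoint T₀.faces T₁.faces) (α₀ α₁ : Slope) (D : ℕ) :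
    ∃ (Q : TorusPair) (φ : H1 ≃+ H1),
      (TorusPair.mk X T₀ T₁ hT).LayersTo (2 * D) Q φ ∧
      Q.glue.IsManifold ∧
      (X.IsOrientable → Q.glue.IsOrientable) ∧
      Q.glue.numTet = X.numTet + 2 * D ∧
      (D : ℕ∞) < fareyGraph.edist α₀ (α₁.map φ) := by
  obtain ⟨Q, φ, h, hc, hd⟩ :=
    (TorusPair.mk X T₀ T₁ hT).exists_compatible_lt_edist α₀ α₁ D
  exact ⟨Q, φ, h, Triangulation.glueTori_isManifold _ (h.isManifold hX),
    fun ho => TorusPair.glue_isOrientable hc (h.isOrientable ho), h.numTet, hd⟩
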